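/- Let $n>1$, $J\ge 1$, $N=2^J-1$, and observe $y_{j,k}=\theta_{j,k}+n^{-1/2}z_{j,k}$ for $0\le j\le J-1$, $1\le k\le 2^j$, where the $z_{j,k}$ are i.i.d. $N(0,1)$ and $\theta\in\mathbb R^N$. For $p\ge 2$, $q>0$ (the value $\infty$ allowed, with the usual convention), $M>0$ and $s=\beta+\frac12-\frac1p>0$ let $$B^\beta_{p,q}(M)=\Big\{\theta:\Big(\sum_{j=0}^{J-1}\Big(2^{js}\Big(\sum_{k=1}^{2^j}|\theta_{j,k}|^p\Big)^{1/p}\Big)^q\Big)^{1/q}\le M\Big\}.$$ Let $0<\alpha<1$, $z_a=\Phi^{-1}(1-a)$ with $\Phi$ the standard normal distribution function, and let $\lambda_*=6.9368\ldots$ be the root greater than $1$ of $\lambda-\log\lambda=5$. Write $\theta_j=(\theta_{j,k})_k$ and $y_j=(y_{j,k})_k$. If $2^j\ge\log n$, put $L=\lceil\log n\rceil$ and divide $\{1,\dots,2^j\}$ into $\lfloor 2^j/L\rfloor$ consecutive blocks $B_i$ of length $L_i=L$, except that the last block also contains the fewer than $L$ indices left over. Put $S_i^2=\sum_{k\in B_i}y_{j,k}^2$;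 define the center $\hat\theta_j$ by $\hat\theta_{j,k}=y_{j,k}\,I(S_i^2\ge\lambda_*L_in^{-1})$ for $k\in B_i$, and the radius $r_\alpha\ge 0$ by $$r_\alpha^2=\Big[2\log^{1/2}\big(\tfrac2\alpha\big)+4\lambda_*^{1/2}z_{\alpha/2}\Big]2^{j/2}n^{-1}+\Big(\sum_i(S_i^2-L_in^{-1})I(S_i^2\le\lambda_*L_in^{-1})\Big)_++(2\lambda_*+8\lambda_*^{1/2}-1)\,n^{-1}\sum_{i:\,S_i^2>\lambda_*L_in^{-1}}L_i.$$ If $2^j<\log n$, put $\hat\theta_j=y_j$ and let $nr_\alpha^2$ be the $1-\alpha$ quantile of the chi-squared distribution with $2^j$ degrees of freedom. Let $CB_*(\hat\theta_j,r_\alpha)=\{v\in\mathbb R^{2^j}:\|v-\hat\theta_j\|_2\le r_\alpha\}$. (i) If $2^j\le n^2$, then $$\inf_{\theta\in\mathbb R^N}P\big(\theta_j\in CB_*(\hat\theta_j,r_\alpha)\big)\ge 1-\alpha-\frac{2}{\log n}.$$ (ii) For every $\beta$ there is a constant $C_\beta$, depending only on $\beta$, such that if $\log n\le 2^j\le n^2$,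 then $$\sup_{\theta\in B^\beta_{p,q}(M)}E(r_\alpha^2)\le\Big[2\log^{1/2}\big(\tfrac2\alpha\big)+4\lambda_*^{1/2}z_{\alpha/2}+4\Big]2^{j/2}n^{-1}+C_\beta\min\big(2^jn^{-1},M^22^{-2\beta j}\big).$$ -/

import Mathlib

open MeasureTheory ProbabilityTheory
open scoped ENNReal

noncomputable section

namespace ConfBall

/-- Arrays `(v_{j,k})` with `0 ≤ j ≤ J - 1`; the `2 ^ j` positions at level `j` are numbered
from `0`. This is `ℝ^N` with `N = 2 ^ J - 1`. -/
abbrev Coeffs (J : ℕ) : Type := (j : Fin J) → Fin (2 ^ (j : ℕ)) → ℝ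

/-- The law of the noise `(z_{j,k})`: independent standard normal variables. -/
def noise (J : ℕ) : Measure (Coeffs J) :=
  Measure.pi fun j : Fin J => Measure.pi fun _ : Fin (2 ^ (j : ℕ)) => gaussianReal 0 1

/-- The observations `y_{j,k} = θ_{j,k} + n^{-1/2} z_{j,k}`. -/
def obs {J : ℕ} (n : ℝ) (θ z : Coeffs J) : Coeffs J :=
  fun j k => θ j k + (1 / Real.sqrt n) * z j k

/-- The Besov body: the `ℓ^q` norm over the levels `j` of
`2 ^ (j s)` times the `ℓ^p` norm of the `j`th level is at most `M`, `s = β + 1/2 - 1/p`. -/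
def besovBody (J : ℕ) (β : ℝ) (p q : ℝ≥0∞) (M : ℝ) : Set (Coeffs J) :=
  {θ | ‖WithLp.toLp q (fun j : Fin J =>
      (2 : ℝ) ^ (((j : ℕ) : ℝ) * (β + 1 / 2 - (p⁻¹).toReal)) * ‖WithLp.toLp p (θ j)‖)‖ ≤ M}

/-- The quantile function of a law on the line. -/
def quantile (μ : Measure ℝ) (u : ℝ) : ℝ := sInf {x : ℝ | u ≤ μ.real (Set.Iic x)}

/-- `z_a = Φ⁻¹(1 - a)`. -/
def zUpper (a : ℝ) : ℝ := quantile (gaussianReal 0 1) (1 - a)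

/-- The central chi-squared law with `m` degrees of freedom. -/
def chiSqLaw (m : ℕ) : Measure ℝ :=
  (Measure.pi fun _ : Fin m => gaussianReal 0 1).map fun z => ∑ k, z k ^ 2

theorem exists_lambdaStar : ∃ x : ℝ, 1 < x ∧ x - Real.log x = 5 := by
  have hc : ContinuousOn (fun x : ℝ => x - Real.log x) (Set.Icc 1 25) :=
    continuousOn_id.sub (Real.continuousOn_log.mono fun x hx => by
      have : (1 : ℝ) ≤ x := hx.1
      simp only [Set.mem_compl_iff, Set.mem_singleton_iff]
      linarith)
  have h25 : Real.log 25 ≤ 10 := by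
    have h5 := Real.log_le_sub_one_of_pos (show (0 : ℝ) < 5 by norm_num)
    have h : Real.log 25 = 2 * Real.log 5 := by
      rw [show (25 : ℝ) = 5 ^ 2 by norm_num, Real.log_pow]
      norm_num
    linarith
  have hmem : (5 : ℝ) ∈ Set.Icc ((1 : ℝ) - Real.log 1) (25 - Real.log 25) := by
    constructor
    · simp
    · linarith
  obtain ⟨x, hx, hx5⟩ := intermediate_value_Icc (by norm_num) hc hmem
  have hx5' : x - Real.log x = 5 := hx5
  refine ⟨x, lt_of_le_of_ne hx.1 ?_, hx5'⟩
  rintro rfl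
  norm_num at hx5'

/-- `λ_* = 6.9368…`, the root greater than `1` of `λ - log λ = 5` (the function
`λ - log λ` is strictly increasing there). -/
def lambdaStar : ℝ := exists_lambdaStar.choose

theorem lambdaStar_spec : 1 < lambdaStar ∧ lambdaStar - Real.log lambdaStar = 5 :=
  exists_lambdaStar.choose_spec

/-- The block length `log n`, rounded up to an integer. -/
def blockLen (n : ℝ) : ℕ := ⌈Real.log n⌉₊

/-- The number of blocks at level `j`. -/
def numBlocks (n : ℝ) (j : ℕ) : ℕ := 2 ^ j / blockLen n

/-- The number (from `0`) of the block that contains position `k`: consecutive blocks of length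
`blockLen n`, the last one taking also the positions that are left over. -/
def blockIndex (n : ℝ) {j : ℕ} (k : Fin (2 ^ j)) : ℕ :=
  min ((k : ℕ) / blockLen n) (numBlocks n j - 1)

/-- The positions in block number `i`. -/
def block (n : ℝ) (j i : ℕ) : Finset (Fin (2 ^ j)) :=
  Finset.univ.filter fun k => blockIndex n k = i

/-- The length of block number `i`; it is `blockLen n` except perhaps for the last block. -/
def len (n : ℝ) (j i : ℕ) : ℝ := ((block n j i).card : ℝ)

/-- The energy `S²` of the observations in block number `i`. -/
def blockSq (n : ℝ) {j : ℕ} (y : Fin (2 ^ j) → ℝ) (i : ℕ) : ℝ :=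
  ∑ k ∈ block n j i, y k ^ 2

/-- The local block thresholding estimator at one level. -/
def blockEst (n : ℝ) {j : ℕ} (y : Fin (2 ^ j) → ℝ) : Fin (2 ^ j) → ℝ := fun k =>
  if lambdaStar * len n j (blockIndex n k) * n⁻¹ ≤ blockSq n y (blockIndex n k) then y k else 0

open Classical in
/-- The squared radius used at levels with `log n ≤ 2 ^ j`. -/
def blockRadiusSq (n α : ℝ) {j : ℕ} (y : Fin (2 ^ j) → ℝ) : ℝ :=
  (2 * Real.sqrt (Real.log (2 / α)) + 4 * Real.sqrt lambdaStar * zUpper (α / 2))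
      * (2 : ℝ) ^ ((j : ℝ) / 2) * n⁻¹
    + max 0 (∑ i ∈ Finset.range (numBlocks n j),
        if blockSq n y i ≤ lambdaStar * len n j i * n⁻¹
        then blockSq n y i - len n j i * n⁻¹ else 0)
    + (2 * lambdaStar + 8 * Real.sqrt lambdaStar - 1) * n⁻¹ *
        ∑ i ∈ (Finset.range (numBlocks n j)).filter
          (fun i => lambdaStar * len n j i * n⁻¹ < blockSq n y i), len n j i

open Classical in
/-- The center of the ball: the block thresholding estimator, or the observations themselves at
the coarse levels `2 ^ j < log n`. -/
def center (n : ℝ) {j : ℕ} (y : Fin (2 ^ j) → ℝ) : Fin (2 ^ j) → ℝ :=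
  if Real.log n ≤ (2 : ℝ) ^ j then blockEst n y else y

open Classical in
/-- The radius of the ball; at the coarse levels `2 ^ j < log n` it is that of the usual ball
centered at the observations, whose squared radius is `n⁻¹` times the `1 - α` quantile of the
chi-squared law with `2 ^ j` degrees of freedom. -/
def radius (n α : ℝ) {j : ℕ} (y : Fin (2 ^ j) → ℝ) : ℝ :=
  if Real.log n ≤ (2 : ℝ) ^ j then Real.sqrt (blockRadiusSq n α y)
  else Real.sqrt (quantile (chiSqLaw (2 ^ j)) (1 - α) * n⁻¹)

/-- The confidence ball for the `j`th level of the mean vector. -/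
def confBall (n α : ℝ) {j : ℕ} (y : Fin (2 ^ j) → ℝ) : Set (Fin (2 ^ j) → ℝ) :=
  {v | ‖WithLp.toLp 2 (v - center n y)‖ ≤ radius n α y}

end ConfBall

end

/-!
The squared radius is an unbiased estimate of the loss plus corrections for the noise in it. After
multiplication by `√n` the data are `x = μ + z` with `z` standard normal. For a block of length
`l` let `T`, `Ξ`, `X` be the energies of `x`, `μ`, `z`, and `c = ⟨μ, z⟩`, so that
`T = Ξ + 2 c + X`. A block with `T < λ l` is estimated by zero and its loss is
`Ξ = (T - l) - 2 c - (X - l)`; a block with `T > λ l` is kept and its loss is `X`.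

Coverage. Outside an event of probability at most `e^{-2l}` one has `X < λ l`; the equation
`λ - log λ = 5` is what turns the Chernoff bound into this rate. Then every block that is killed
has `Ξ < 4 λ l`. The cross terms are therefore controlled through the deterministic set of blocks
with `Ξ ≤ 4 λ l`: their sum over this set is Gaussian with variance at most `4 λ 2^j`, which gives
the term with `z_{α/2}`, and for a kept block of this set `c < 4 √λ l` outside another event of
probability at most `e^{-2l}`, which gives the term `8 √λ`. The sum of `X - l` over all blocks is
controlled by the lower tail of the chi-squared law, which gives the term with `log (2 / α)`. Since
`l ≥ log n` and there are at most `n² / log n` blocks, the events for single blocks have total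
probability at most `2 / log n`. These steps are `block_loss_le`, `measureReal_lambdaStar_le`,
`measureReal_sum_mul_gt_le`, `measureReal_sum_sq_le_le` and `measureReal_compl_le_of_loss_le`.

Expected radius. Kept blocks have `T ≥ l`, so the sum of `T - l` over the killed blocks is at most
the sum `Y + ∑ μ²` over all of them, where `Y` is centred with variance `4 ∑ μ² + 2 · 2^j`; the
bound `y₊ ≤ (y + w)² / (4 w)` with `w = 2^{j/2}` then gives `3/4 · w + 2 ∑ μ²`. A block is kept only
if `X ≥ 6.9 l` or `Ξ ≥ 10⁻⁶ l`, and the probability of the former is small compared with `w⁻¹`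
(`measureReal_blockSq_ge_mul_le`). The constant `4` in the theorem is close enough to what is
needed that blocks of length one and two require sharper tail bounds than the exponential one.
On the Besov body Hölder's inequality bounds `∑ θ²` by `M² 2^{-2βj}`.
-/

noncomputable section

namespace ConfBall

/-! ### Moments and exponential moments of Gaussian vectors -/

theorem integral_exp_mul_sq_gaussianReal {t : ℝ} (ht : t < 1 / 2) :
    ∫ x, Real.exp (t * x ^ 2) ∂gaussianReal 0 1 = (Real.sqrt (1 - 2 * t))⁻¹ := by
  rw [integral_gaussianReal_eq_integral_smul one_ne_zero]
  have h : ∀ x : ℝ, gaussianPDFReal 0 1 x • Real.exp (t * x ^ 2) =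
      (Real.sqrt (2 * Real.pi))⁻¹ * Real.exp (-(1 / 2 - t) * x ^ 2) := by
    intro x
    simp only [gaussianPDFReal, smul_eq_mul, NNReal.coe_one, mul_one, sub_zero, mul_assoc]
    rw [← Real.exp_add]
    congr 2
    ring
  simp_rw [h]
  rw [integral_const_mul, integral_gaussian, ← Real.sqrt_inv, ← Real.sqrt_mul (by positivity),
    ← Real.sqrt_inv]
  congr 1
  have : 1 - 2 * t ≠ 0 := by linarith
  have : 1 / 2 - t ≠ 0 := by linarith
  field_simp

theorem integrable_pow_gaussianReal (n : ℕ) :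
    Integrable (fun x : ℝ => x ^ n) (gaussianReal 0 1) := by
  have h := (memLp_id_gaussianReal (μ := 0) (v := 1) (n : NNReal)).integrable_norm_pow'
  refine (integrable_norm_iff (by fun_prop)).1 ?_
  simpa using h

open scoped Nat in
theorem integral_even_pow_gaussianReal (k : ℕ) :
    ∫ x, x ^ (2 * k) ∂gaussianReal 0 1 = ((2 * k - 1)‼ : ℕ) := by
  rw [integral_gaussianReal_eq_integral_smul one_ne_zero]
  have h : ∀ x : ℝ, gaussianPDFReal 0 1 x • x ^ (2 * k) =
      (fun u : ℝ => (Real.sqrt (2 * Real.pi))⁻¹ *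
        (u ^ (((2 * k : ℕ) : ℝ)) * Real.exp (-(1 / 2) * u ^ (2 : ℝ)))) |x| := by
    intro x
    simp only [gaussianPDFReal, smul_eq_mul, NNReal.coe_one, mul_one, sub_zero]
    rw [Real.rpow_natCast, Real.rpow_two, sq_abs, pow_mul, pow_mul, sq_abs, mul_assoc]
    congr 1
    rw [mul_comm]
    congr 2
    ring
  rw [integral_congr_ae (Filter.Eventually.of_forall h),
    integral_comp_abs (f := fun u : ℝ => (Real.sqrt (2 * Real.pi))⁻¹ *
        (u ^ (((2 * k : ℕ) : ℝ)) * Real.exp (-(1 / 2) * u ^ (2 : ℝ)))), integral_const_mul,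
    integral_rpow_mul_exp_neg_mul_rpow (by norm_num) (by
      have : (0 : ℝ) ≤ ((2 * k : ℕ) : ℝ) := by positivity
      linarith) (by norm_num)]
  have e : (((2 * k : ℕ) : ℝ) + 1) / 2 = k + 1 / 2 := by push_cast; ring
  rw [neg_div, e, Real.Gamma_nat_add_half, Real.rpow_neg (by norm_num),
    Real.rpow_add (by norm_num), Real.rpow_natCast, ← Real.sqrt_eq_rpow,
    Real.sqrt_mul (by norm_num), Real.sqrt_div (by norm_num), Real.sqrt_one]
  have h2 : Real.sqrt 2 ≠ 0 := by positivity
  have h3 : Real.sqrt Real.pi ≠ 0 := by positivity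
  field_simp
  rw [← mul_pow]
  norm_num

theorem integral_odd_pow_gaussianReal {n : ℕ} (hn : Odd n) :
    ∫ x, x ^ n ∂gaussianReal 0 1 = 0 := by
  have h : ∫ x, x ^ n ∂gaussianReal 0 1 = ∫ x, (-x) ^ n ∂gaussianReal 0 1 := by
    conv_lhs => rw [show gaussianReal 0 1 = (gaussianReal 0 1).map (fun x => -x) by
      rw [gaussianReal_map_neg, neg_zero]]
    rw [integral_map (by fun_prop) (by fun_prop)]
  simp_rw [hn.neg_pow, integral_neg] at h
  linarith

/-- The law of a vector of independent standard normal variables indexed by `ι`. -/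
abbrev stdNormal (ι : Type*) [Fintype ι] : Measure (ι → ℝ) := Measure.pi fun _ => gaussianReal 0 1

section Vectors

variable {ι : Type*} [Fintype ι]

theorem iIndepFun_stdNormal {f : ι → ℝ → ℝ} (hf : ∀ i, Measurable (f i)) :
    iIndepFun (fun i (z : ι → ℝ) => f i (z i)) (stdNormal ι) :=
  iIndepFun_pi fun i => (hf i).aemeasurable

theorem mgf_sum_sq {t : ℝ} (ht : t < 1 / 2) (s : Finset ι) :
    mgf (fun z : ι → ℝ => ∑ k ∈ s, z k ^ 2) (stdNormal ι) t =
      (Real.sqrt (1 - 2 * t))⁻¹ ^ s.card := by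
  have h := (iIndepFun_stdNormal (ι := ι) (f := fun _ x => x ^ 2)
    (fun _ => by fun_prop)).mgf_sum (t := t) (fun _ => by fun_prop) s
  have e : (∑ i ∈ s, fun z : ι → ℝ => z i ^ 2) = fun z => ∑ k ∈ s, z k ^ 2 := by
    ext z; simp
  rw [e] at h
  rw [h, Finset.prod_congr rfl (g := fun _ => (Real.sqrt (1 - 2 * t))⁻¹), Finset.prod_const]
  intro i _
  rw [mgf, ← integral_exp_mul_sq_gaussianReal ht]
  exact integral_comp_eval (μ := fun _ : ι => gaussianReal 0 1)
    (f := fun x : ℝ => Real.exp (t * x ^ 2)) (by fun_prop)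

theorem integrable_exp_mul_sum_sq {t : ℝ} (ht : t < 1 / 2) (s : Finset ι) :
    Integrable (fun z : ι → ℝ => Real.exp (t * ∑ k ∈ s, z k ^ 2)) (stdNormal ι) := by
  by_contra h
  have h1 := mgf_sum_sq ht s
  rw [mgf, integral_undef h] at h1
  have : 0 < Real.sqrt (1 - 2 * t) := Real.sqrt_pos.2 (by linarith)
  have : 0 < (Real.sqrt (1 - 2 * t))⁻¹ ^ s.card := by positivity
  linarith

theorem inv_sqrt_pow_eq_exp {x : ℝ} (hx : 0 < x) (n : ℕ) :
    (Real.sqrt x)⁻¹ ^ n = Real.exp (-(n / 2) * Real.log x) := by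
  rw [← Real.exp_log (Real.sqrt_pos.2 hx), ← Real.exp_neg, ← Real.exp_nat_mul, Real.log_sqrt hx.le]
  congr 1
  ring

/-- The Chernoff bound for the upper tail of a chi-squared variable; the exponent `t` of the
usual bound is `(1 - 1 / c) / 2`. -/
theorem measureReal_sum_sq_ge_le {c : ℝ} (hc : 1 ≤ c) (x : ℝ) (s : Finset ι) :
    (stdNormal ι).real {z | x ≤ ∑ k ∈ s, z k ^ 2} ≤
      Real.exp (-((1 - c⁻¹) / 2 * x) + s.card / 2 * Real.log c) := by
  have hc0 : 0 < c := by linarith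
  have hci : c⁻¹ ≤ 1 := inv_le_one_of_one_le₀ hc
  have hci0 : 0 < c⁻¹ := by positivity
  have ht : (1 - c⁻¹) / 2 < 1 / 2 := by linarith
  refine (measure_ge_le_exp_mul_mgf (X := fun z : ι → ℝ => ∑ k ∈ s, z k ^ 2) x
    (by linarith : 0 ≤ (1 - c⁻¹) / 2) (integrable_exp_mul_sum_sq ht s)).trans_eq ?_
  rw [mgf_sum_sq ht, show 1 - 2 * ((1 - c⁻¹) / 2) = c⁻¹ by ring, inv_sqrt_pow_eq_exp hci0,
    ← Real.exp_add, Real.log_inv]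
  congr 1
  ring

/-- The Laurent–Massart bound for the lower tail of a chi-squared variable. -/
theorem measureReal_sum_sq_le_le [Nonempty ι] {x : ℝ} (hx : 0 ≤ x) :
    (stdNormal ι).real {z | ∑ k, z k ^ 2 ≤ Fintype.card ι - 2 * Real.sqrt (Fintype.card ι * x)} ≤
      Real.exp (-x) := by
  set m : ℝ := (Fintype.card ι : ℝ) with hm
  have hm0 : 0 < m := by simp [hm, Fintype.card_pos]
  set v : ℝ := Real.sqrt (m * x) / m with hv
  have hv0 : 0 ≤ v := by positivity
  have hs : Real.sqrt (m * x) ^ 2 = m * x := Real.sq_sqrt (by positivity)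
  have hmv : Real.sqrt (m * x) = m * v := by rw [hv]; field_simp
  have hlog : 2 * v - 2 * v ^ 2 ≤ Real.log (1 + 2 * v) := by
    have h := Real.le_log_one_add_of_nonneg (x := 2 * v) (by positivity)
    refine le_trans ?_ h
    rw [le_div_iff₀ (by positivity)]
    nlinarith [pow_nonneg hv0 3, pow_nonneg hv0 2]
  refine (measure_le_le_exp_mul_mgf (X := fun z : ι → ℝ => ∑ k, z k ^ 2) _
    (by linarith : -v ≤ 0) (integrable_exp_mul_sum_sq (by linarith) _)).trans ?_
  rw [mgf_sum_sq (by linarith), inv_sqrt_pow_eq_exp (by linarith), ← Real.exp_add,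
    Finset.card_univ, ← hm]
  apply Real.exp_le_exp.2
  rw [hmv] at hs ⊢
  have h2 : x = m * v ^ 2 := by
    have : m * (m * v ^ 2) = m * x := by rw [← hs]; ring
    exact (mul_left_cancel₀ hm0.ne' this).symm
  rw [show 1 - 2 * -v = 1 + 2 * v by ring, h2]
  nlinarith

theorem map_sum_mul_stdNormal (a : ι → ℝ) (s : Finset ι) :
    (stdNormal ι).map (fun z => ∑ k ∈ s, a k * z k) =
      gaussianReal 0 (∑ k ∈ s, Real.toNNReal (a k ^ 2)) := by
  classical
  have hI := iIndepFun_stdNormal (ι := ι) (f := fun i x => a i * x) (fun _ => by fun_prop)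
  have e : ∀ s : Finset ι, (∑ i ∈ s, fun z : ι → ℝ => a i * z i) = fun z => ∑ k ∈ s, a k * z k := by
    intro s; ext z; simp
  induction s using Finset.induction_on with
  | empty => simp
  | insert i s hi ih =>
    have h1 : (stdNormal ι).map (fun z => a i * z i) =
        gaussianReal 0 (Real.toNNReal (a i ^ 2)) := by
      have h2 := gaussianReal_map_const_mul (μ := 0) (v := 1) (a i)
      rw [← (measurePreserving_eval (fun _ : ι => gaussianReal 0 1) i).map_eq,
        Measure.map_map (measurable_const_mul _) (by exact measurable_pi_apply i)] at h2
      refine Eq.trans h2 ?_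
      congr 1
      · simp
      · ext; simp [sq_nonneg]
    have h := gaussianReal_add_gaussianReal_of_indepFun
      (hI.indepFun_finsetSum_of_notMem (fun _ => by fun_prop) hi) (by rw [e]; exact ih) h1
    rw [e] at h
    rw [Finset.sum_insert hi, add_comm (Real.toNNReal _)]
    rw [add_zero] at h
    rw [← h]
    congr 1
    ext z
    simp [Finset.sum_insert hi, add_comm]

/-- The Chernoff bound for a linear form in a Gaussian vector. -/
theorem measureReal_sum_mul_ge_le (a : ι → ℝ) (s : Finset ι) {x v : ℝ} (hx : 0 ≤ x) (hv : 0 < v)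
    (ha : ∑ k ∈ s, a k ^ 2 ≤ v) :
    (stdNormal ι).real {z | x ≤ ∑ k ∈ s, a k * z k} ≤ Real.exp (-(x ^ 2 / (2 * v))) := by
  have hm := map_sum_mul_stdNormal a s
  have hint : Integrable (fun z : ι → ℝ => Real.exp (x / v * ∑ k ∈ s, a k * z k))
      (stdNormal ι) := by
    have h := integrable_exp_mul_gaussianReal (μ := 0)
      (v := ∑ k ∈ s, Real.toNNReal (a k ^ 2)) (x / v)
    rw [← hm, integrable_map_measure (by fun_prop) (Measurable.aemeasurable (by fun_prop))] at h
    exact h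
  refine (measure_ge_le_exp_mul_mgf (X := fun z : ι → ℝ => ∑ k ∈ s, a k * z k) x
    (by positivity : 0 ≤ x / v) hint).trans ?_
  rw [mgf_gaussianReal hm, ← Real.exp_add]
  apply Real.exp_le_exp.2
  have e : ((∑ k ∈ s, Real.toNNReal (a k ^ 2) : NNReal) : ℝ) = ∑ k ∈ s, a k ^ 2 := by
    push_cast
    exact Finset.sum_congr rfl fun k _ => Real.coe_toNNReal _ (sq_nonneg _)
  rw [e]
  have h2 : (∑ k ∈ s, a k ^ 2) * (x / v) ^ 2 / 2 ≤ v * (x / v) ^ 2 / 2 := by gcongr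
  have h3 : v * (x / v) ^ 2 / 2 = x ^ 2 / (2 * v) := by field_simp
  have h4 : -(x / v) * x = - 2 * (x ^ 2 / (2 * v)) := by field_simp
  rw [h4]
  linarith

/-- A noncentral chi-squared variable has no atoms. Hence the event `S² = λ l`, on which the center
keeps a block while the radius treats it as killed, is negligible. -/
theorem measure_sum_sq_eq (μ : ι → ℝ) {s : Finset ι} (hs : s.Nonempty) (c : ℝ) :
    stdNormal ι {z | ∑ k ∈ s, (μ k + z k) ^ 2 = c} = 0 := by
  classical
  obtain ⟨i, hi⟩ := hs
  have hI := iIndepFun_stdNormal (ι := ι) (f := fun i x => (μ i + x) ^ 2) (fun _ => by fun_prop)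
  have h1 := hI.indepFun_finsetSum_of_notMem (fun _ => by fun_prop) (Finset.notMem_erase i s)
  have e : (∑ j ∈ s.erase i, fun z : ι → ℝ => (μ j + z j) ^ 2) =
      fun z => ∑ j ∈ s.erase i, (μ j + z j) ^ 2 := by ext z; simp
  rw [e] at h1
  have h2 := (indepFun_iff_map_prod_eq_prod_map_map (Measurable.aemeasurable (by fun_prop))
    (Measurable.aemeasurable (by fun_prop))).1 h1
  have hset : {z : ι → ℝ | ∑ k ∈ s, (μ k + z k) ^ 2 = c} =
      (fun z => (∑ j ∈ s.erase i, (μ j + z j) ^ 2, (μ i + z i) ^ 2)) ⁻¹'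
        {p : ℝ × ℝ | p.1 + p.2 = c} := by
    ext z
    simp [Finset.sum_erase_add _ _ hi]
  have hm : MeasurableSet {p : ℝ × ℝ | p.1 + p.2 = c} :=
    measurableSet_eq_fun (by fun_prop) (by fun_prop)
  rw [hset, ← Measure.map_apply (by fun_prop) hm, h2, Measure.prod_apply hm]
  refine lintegral_eq_zero_of_ae_eq_zero (Filter.Eventually.of_forall fun x => ?_)
  have hm' : MeasurableSet (Prod.mk x ⁻¹' {p : ℝ × ℝ | p.1 + p.2 = c}) :=
    hm.preimage (by fun_prop)
  change Measure.map (fun z : ι → ℝ => (μ i + z i) ^ 2) (stdNormal ι) _ = 0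
  rw [Measure.map_apply (by fun_prop) hm']
  have hsub : {w : ℝ | x + (μ i + w) ^ 2 = c} ⊆
      {Real.sqrt (c - x) - μ i, -Real.sqrt (c - x) - μ i} := by
    intro w hw
    have hw' : (μ i + w) ^ 2 = c - x := by
      have : x + (μ i + w) ^ 2 = c := hw
      linarith
    have h0 : 0 ≤ c - x := hw' ▸ sq_nonneg _
    rw [← Real.sq_sqrt h0] at hw'
    rcases sq_eq_sq_iff_eq_or_eq_neg.1 hw' with h | h
    · left; linarith
    · right; simp only [Set.mem_singleton_iff]; linarith
  have := nullSingletonClass_gaussianReal (μ := 0) (one_ne_zero (α := NNReal))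
  have h0 : gaussianReal 0 1 {w : ℝ | x + (μ i + w) ^ 2 = c} = 0 :=
    measure_mono_null hsub ((Set.toFinite _).measure_zero _)
  have hp := (measurePreserving_eval (fun _ : ι => gaussianReal 0 1) i).measure_preimage
    (s := {w : ℝ | x + (μ i + w) ^ 2 = c})
    (measurableSet_eq_fun (by fun_prop) (by fun_prop)).nullMeasurableSet
  rw [h0] at hp
  exact hp

end Vectors

/-! ### Quantiles -/

open Filter Topology in
theorem le_measureReal_Iic_quantile (μ : Measure ℝ) [IsProbabilityMeasure μ] {u : ℝ}
    (h0 : 0 < u) (h1 : u < 1) : u ≤ μ.real (Set.Iic (quantile μ u)) := by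
  set S : Set ℝ := {x : ℝ | u ≤ μ.real (Set.Iic x)} with hS
  have hmem : ∀ x, x ∈ S ↔ u ≤ cdf μ x := fun x => by rw [cdf_eq_real]; rfl
  have hne : S.Nonempty := by
    obtain ⟨x, hx⟩ := ((tendsto_cdf_atTop μ).eventually (lt_mem_nhds h1)).exists
    exact ⟨x, (hmem x).2 hx.le⟩
  have hbdd : BddBelow S := by
    obtain ⟨x, hx⟩ := ((tendsto_cdf_atBot μ).eventually (gt_mem_nhds h0)).exists
    refine ⟨x, fun y hy => ?_⟩
    by_contra hlt
    exact absurd (((hmem y).1 hy).trans (monotone_cdf μ (not_le.1 hlt).le)) (not_le.2 hx)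
  change u ≤ μ.real (Set.Iic (sInf S))
  rw [← cdf_eq_real]
  by_contra hlt
  have hc := (cdf μ).right_continuous (sInf S)
  have hev : ∀ᶠ x in 𝓝[≥] (sInf S), cdf μ x < u := hc.eventually (gt_mem_nhds (not_le.1 hlt))
  obtain ⟨b, hb, hb'⟩ := (mem_nhdsGE_iff_exists_Ico_subset).1 hev
  obtain ⟨s, hs, hsb⟩ := exists_lt_of_csInf_lt hne (Set.mem_Ioi.1 hb)
  exact absurd ((hmem s).1 hs) (not_le.2 (hb' ⟨csInf_le hbdd hs, hsb⟩))

theorem zUpper_nonneg {a : ℝ} (ha : a < 1 / 2) : 0 ≤ zUpper a := by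
  refine Real.sInf_nonneg fun x hx => ?_
  by_contra hneg
  rw [not_le] at hneg
  have hx' : 1 - a ≤ (gaussianReal 0 1).real (Set.Iic x) := hx
  have hsymm : (gaussianReal 0 1).real (Set.Ici (-x)) = (gaussianReal 0 1).real (Set.Iic x) := by
    conv_lhs => rw [show gaussianReal 0 1 = (gaussianReal 0 1).map (fun x => -x) by
      rw [gaussianReal_map_neg, neg_zero]]
    rw [map_measureReal_apply (by fun_prop) measurableSet_Ici]
    congr 1
    ext y
    simp
  have hdisj : Disjoint (Set.Iic x) (Set.Ici (-x)) := by
    rw [Set.disjoint_left]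
    intro y hy hy'
    have h1 : y ≤ x := hy
    have h2 : -x ≤ y := hy'
    linarith
  have h := measureReal_union (μ := gaussianReal 0 1) hdisj measurableSet_Ici
  have h1 : (gaussianReal 0 1).real (Set.Iic x ∪ Set.Ici (-x)) ≤ 1 := measureReal_le_one
  linarith

theorem gaussianReal_zUpper_lt_le {a : ℝ} (h0 : 0 < a) (h1 : a < 1) :
    (gaussianReal 0 1).real (Set.Ioi (zUpper a)) ≤ a := by
  have h := le_measureReal_Iic_quantile (gaussianReal 0 1) (u := 1 - a) (by linarith) (by linarith)
  have h2 := probReal_compl_eq_one_sub (μ := gaussianReal 0 1) (s := Set.Iic (zUpper a))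
    measurableSet_Iic
  rw [Set.compl_Iic] at h2
  rw [h2]
  change 1 - a ≤ (gaussianReal 0 1).real (Set.Iic (zUpper a)) at h
  linarith

/-- The upper quantile bound for a linear form in a Gaussian vector; `zUpper ε ≥ 0` is what allows
its standard deviation to be replaced by an upper bound `w`. -/
theorem measureReal_sum_mul_gt_le {ι : Type*} [Fintype ι] (a : ι → ℝ) (s : Finset ι) {w ε : ℝ}
    (hw : 0 ≤ w) (ha : ∑ k ∈ s, a k ^ 2 ≤ w ^ 2) (h0 : 0 < ε) (h1 : ε < 1 / 2) :
    (stdNormal ι).real {z | w * zUpper ε < ∑ k ∈ s, a k * z k} ≤ ε := by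
  have hm := map_sum_mul_stdNormal a s
  set V := ∑ k ∈ s, Real.toNNReal (a k ^ 2) with hV
  have hVe : (V : ℝ) = ∑ k ∈ s, a k ^ 2 := by
    rw [hV]
    push_cast
    exact Finset.sum_congr rfl fun k _ => Real.coe_toNNReal _ (sq_nonneg _)
  have hg : gaussianReal 0 V = (gaussianReal 0 1).map (fun x => Real.sqrt V * x) := by
    rw [gaussianReal_map_const_mul]
    congr 1
    · simp
    · ext; simp
  have hset : {z : ι → ℝ | w * zUpper ε < ∑ k ∈ s, a k * z k} =
      (fun z => ∑ k ∈ s, a k * z k) ⁻¹' Set.Ioi (w * zUpper ε) := rfl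
  rw [hset, ← map_measureReal_apply (by fun_prop) measurableSet_Ioi, hm, hg,
    map_measureReal_apply (by fun_prop) measurableSet_Ioi]
  refine (measureReal_mono ?_).trans (gaussianReal_zUpper_lt_le h0 (by linarith))
  intro x hx
  have hx' : w * zUpper ε < Real.sqrt V * x := hx
  by_contra hle
  have hle' : x ≤ zUpper ε := not_lt.1 hle
  have h3 : Real.sqrt V ≤ w := Real.sqrt_le_iff.2 ⟨hw, by rw [hVe]; exact ha⟩
  have h4 := zUpper_nonneg h1
  have h5 : Real.sqrt V * x ≤ w * zUpper ε :=
    (mul_le_mul_of_nonneg_left hle' (Real.sqrt_nonneg _)).trans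
      (mul_le_mul_of_nonneg_right h3 h4)
  linarith

/-! ### The block partition -/

section Blocks

variable {n : ℝ} {j : ℕ}

theorem mem_block {i : ℕ} {k : Fin (2 ^ j)} : k ∈ block n j i ↔ blockIndex n k = i := by
  unfold block
  rw [Finset.mem_filter]
  exact and_iff_right (Finset.mem_univ k)

theorem blockLen_pos (hn : 1 < n) : 0 < blockLen n := Nat.ceil_pos.2 (Real.log_pos hn)

theorem log_le_blockLen (n : ℝ) : Real.log n ≤ blockLen n := Nat.le_ceil _

theorem blockLen_le (hj : Real.log n ≤ (2 : ℝ) ^ j) : blockLen n ≤ 2 ^ j :=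
  Nat.ceil_le.2 (by exact_mod_cast hj)

theorem numBlocks_pos (hn : 1 < n) (hj : Real.log n ≤ (2 : ℝ) ^ j) : 0 < numBlocks n j :=
  Nat.div_pos (blockLen_le hj) (blockLen_pos hn)

theorem blockIndex_lt (hn : 1 < n) (hj : Real.log n ≤ (2 : ℝ) ^ j) (k : Fin (2 ^ j)) :
    blockIndex n k < numBlocks n j := by
  have := numBlocks_pos hn hj
  unfold blockIndex
  omega

theorem sum_blocks (hn : 1 < n) (hj : Real.log n ≤ (2 : ℝ) ^ j) (f : Fin (2 ^ j) → ℝ) :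
    ∑ i ∈ Finset.range (numBlocks n j), ∑ k ∈ block n j i, f k = ∑ k, f k :=
  Finset.sum_fiberwise_of_maps_to (fun k _ => Finset.mem_range.2 (blockIndex_lt hn hj k)) f

theorem blockLen_le_card_block {i : ℕ} (hi : i < numBlocks n j) :
    blockLen n ≤ (block n j i).card := by
  have hL : 0 < blockLen n := by
    by_contra h0
    have h1 : blockLen n = 0 := by omega
    simp [numBlocks, h1] at hi
  have hmul : numBlocks n j * blockLen n ≤ 2 ^ j := Nat.div_mul_le_self _ _
  have hle : (i + 1) * blockLen n ≤ 2 ^ j :=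
    (Nat.mul_le_mul_right _ hi).trans hmul
  have hlt : ∀ t : Fin (blockLen n), i * blockLen n + t < 2 ^ j := fun t => by
    have := t.2
    have h2 : (i + 1) * blockLen n = i * blockLen n + blockLen n := by ring
    omega
  let g : Fin (blockLen n) → Fin (2 ^ j) := fun t => ⟨i * blockLen n + t, hlt t⟩
  have hg : Function.Injective g := by
    intro a b hab
    have : i * blockLen n + (a : ℕ) = i * blockLen n + b := congrArg Fin.val hab
    exact Fin.ext (by omega)
  calc blockLen n = (Finset.univ.image g).card := by
        rw [Finset.card_image_of_injective _ hg, Finset.card_univ, Fintype.card_fin]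
    _ ≤ _ := by
        refine Finset.card_le_card fun x hx => ?_
        obtain ⟨t, -, rfl⟩ := Finset.mem_image.1 hx
        refine mem_block.2 ?_
        change min ((i * blockLen n + (t : ℕ)) / blockLen n) (numBlocks n j - 1) = i
        rw [mul_comm, Nat.mul_add_div hL, Nat.div_eq_of_lt t.2]
        omega

theorem card_block_le {i : ℕ} (hn : 1 < n) :
    (block n j i).card ≤ 2 * blockLen n - 1 := by
  have hL := blockLen_pos hn
  have hsub : (block n j i).map Fin.valEmbedding ⊆
      Finset.Ico (i * blockLen n) (i * blockLen n + (2 * blockLen n - 1)) := by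
    intro x hx
    obtain ⟨k, hk, rfl⟩ := Finset.mem_map.1 hx
    rw [mem_block, blockIndex] at hk
    have hk2 := k.2
    have hm : 2 ^ j < (numBlocks n j + 1) * blockLen n := by
      have := Nat.lt_div_mul_add (a := 2 ^ j) hL
      rw [add_mul, one_mul]
      exact this
    have h1 : (k : ℕ) / blockLen n * blockLen n ≤ k := Nat.div_mul_le_self _ _
    have h2 : (k : ℕ) < (k : ℕ) / blockLen n * blockLen n + blockLen n := Nat.lt_div_mul_add hL
    simp only [Fin.valEmbedding_apply, Finset.mem_Ico]
    rcases le_total ((k : ℕ) / blockLen n) (numBlocks n j - 1) with h | h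
    · rw [min_eq_left h] at hk
      rw [hk] at h1 h2
      omega
    · rw [min_eq_right h] at hk
      have h3 : i * blockLen n ≤ (k : ℕ) / blockLen n * blockLen n :=
        Nat.mul_le_mul_right _ (hk ▸ h)
      have h4 : (numBlocks n j + 1) * blockLen n ≤ (i + 2) * blockLen n :=
        Nat.mul_le_mul_right _ (by omega)
      have h5 : (i + 2) * blockLen n = i * blockLen n + 2 * blockLen n := by ring
      omega
  have h := Finset.card_le_card hsub
  rw [Finset.card_map, Nat.card_Ico] at h
  omega

theorem block_nonempty (hn : 1 < n) {i : ℕ} (hi : i < numBlocks n j) : (block n j i).Nonempty :=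
  Finset.card_pos.1 ((blockLen_pos hn).trans_le (blockLen_le_card_block hi))

theorem blockLen_le_len {i : ℕ} (hi : i < numBlocks n j) : (blockLen n : ℝ) ≤ len n j i := by
  unfold len
  exact_mod_cast blockLen_le_card_block hi

theorem len_pos (hn : 1 < n) {i : ℕ} (hi : i < numBlocks n j) : 0 < len n j i := by
  have := blockLen_le_len hi
  have h2 : (0 : ℝ) < blockLen n := by exact_mod_cast blockLen_pos hn
  linarith

theorem sum_len (hn : 1 < n) (hj : Real.log n ≤ (2 : ℝ) ^ j) :
    ∑ i ∈ Finset.range (numBlocks n j), len n j i = (2 : ℝ) ^ j := by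
  have h := sum_blocks hn hj (fun _ => (1 : ℝ))
  simpa [len] using h

end Blocks

/-! ### Rescaling to unit noise variance -/

theorem lambdaStar_pos : 0 < lambdaStar := by linarith [lambdaStar_spec.1]

theorem obs_eq {J : ℕ} {n : ℝ} (hn : 0 < n) (θ z : Coeffs J) (j : Fin J) :
    obs n θ z j = fun k => (Real.sqrt n)⁻¹ * (Real.sqrt n * θ j k + z j k) := by
  funext k
  have : Real.sqrt n ≠ 0 := (Real.sqrt_pos.2 hn).ne'
  simp only [obs]
  field_simp

section Scaling

variable {n : ℝ} {j : ℕ}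

theorem blockSq_scale (hn : 0 < n) (x : Fin (2 ^ j) → ℝ) (i : ℕ) :
    blockSq n (fun k => (Real.sqrt n)⁻¹ * x k) i = n⁻¹ * blockSq n x i := by
  simp only [blockSq, mul_pow, inv_pow, Real.sq_sqrt hn.le, Finset.mul_sum]

theorem blockSq_nonneg (x : Fin (2 ^ j) → ℝ) (i : ℕ) : 0 ≤ blockSq n x i :=
  Finset.sum_nonneg fun _ _ => sq_nonneg _

theorem sum_blockSq (hn : 1 < n) (hj : Real.log n ≤ (2 : ℝ) ^ j) (x : Fin (2 ^ j) → ℝ) :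
    ∑ i ∈ Finset.range (numBlocks n j), blockSq n x i = ∑ k, x k ^ 2 :=
  sum_blocks hn hj fun k => x k ^ 2

theorem blockSq_add (a b : Fin (2 ^ j) → ℝ) (i : ℕ) :
    blockSq n (fun k => a k + b k) i =
      blockSq n a i + 2 * ∑ k ∈ block n j i, a k * b k + blockSq n b i := by
  simp only [blockSq, Finset.mul_sum, ← Finset.sum_add_distrib]
  exact Finset.sum_congr rfl fun k _ => by ring

/-- The total excess energy `S² - L` of the blocks that are thresholded away, at unit noise
variance. -/
def killedExcess (n : ℝ) {j : ℕ} (x : Fin (2 ^ j) → ℝ) : ℝ :=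
  ∑ i ∈ Finset.range (numBlocks n j),
    if blockSq n x i ≤ lambdaStar * len n j i then blockSq n x i - len n j i else 0

/-- The total length of the blocks that are kept, at unit noise variance. -/
def keptLength (n : ℝ) {j : ℕ} (x : Fin (2 ^ j) → ℝ) : ℝ :=
  ∑ i ∈ Finset.range (numBlocks n j),
    if lambdaStar * len n j i < blockSq n x i then len n j i else 0

/-- The squared radius of the block thresholding ball at unit noise variance. -/
def unitRadiusSq (n α : ℝ) {j : ℕ} (x : Fin (2 ^ j) → ℝ) : ℝ :=
  (2 * Real.sqrt (Real.log (2 / α)) + 4 * Real.sqrt lambdaStar * zUpper (α / 2))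
      * (2 : ℝ) ^ ((j : ℝ) / 2)
    + max 0 (killedExcess n x)
    + (2 * lambdaStar + 8 * Real.sqrt lambdaStar - 1) * keptLength n x

theorem blockRadiusSq_scale (hn : 0 < n) (α : ℝ) (x : Fin (2 ^ j) → ℝ) :
    blockRadiusSq n α (fun k => (Real.sqrt n)⁻¹ * x k) = n⁻¹ * unitRadiusSq n α x := by
  have hi : 0 < n⁻¹ := inv_pos.2 hn
  unfold blockRadiusSq unitRadiusSq killedExcess keptLength
  have h1 : ∀ i, (blockSq n (fun k => (Real.sqrt n)⁻¹ * x k) i ≤ lambdaStar * len n j i * n⁻¹) ↔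
      blockSq n x i ≤ lambdaStar * len n j i := fun i => by
    rw [blockSq_scale hn, mul_comm n⁻¹]
    exact mul_le_mul_iff_left₀ hi
  have h2 : ∀ i, (lambdaStar * len n j i * n⁻¹ < blockSq n (fun k => (Real.sqrt n)⁻¹ * x k) i) ↔
      lambdaStar * len n j i < blockSq n x i := fun i => by
    rw [← not_le, ← not_le, not_iff_not]
    exact h1 i
  rw [Finset.sum_filter]
  simp only [h1, h2]
  have h3 : (∑ i ∈ Finset.range (numBlocks n j),
      if blockSq n x i ≤ lambdaStar * len n j i
        then blockSq n (fun k => (Real.sqrt n)⁻¹ * x k) i - len n j i * n⁻¹ else 0) =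
      n⁻¹ * ∑ i ∈ Finset.range (numBlocks n j),
        if blockSq n x i ≤ lambdaStar * len n j i then blockSq n x i - len n j i else 0 := by
    rw [Finset.mul_sum]
    refine Finset.sum_congr rfl fun i _ => ?_
    rw [blockSq_scale hn]
    split_ifs <;> ring
  have h4 : ∀ S : ℝ, max 0 (n⁻¹ * S) = n⁻¹ * max 0 S := fun S => by
    rw [mul_max_of_nonneg _ _ hi.le, mul_zero]
  rw [h3, h4]
  ring

theorem sum_sub_blockEst_sq (hn : 1 < n) (hj : Real.log n ≤ (2 : ℝ) ^ j)
    (μ z : Fin (2 ^ j) → ℝ) :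
    ∑ k, ((Real.sqrt n)⁻¹ * μ k
        - blockEst n (fun k => (Real.sqrt n)⁻¹ * (μ k + z k)) k) ^ 2 =
      n⁻¹ * ∑ i ∈ Finset.range (numBlocks n j),
        if lambdaStar * len n j i ≤ blockSq n (fun k => μ k + z k) i
          then blockSq n z i else blockSq n μ i := by
  have hn0 : 0 < n := by linarith
  have hi : 0 < n⁻¹ := inv_pos.2 hn0
  rw [← sum_blocks hn hj, Finset.mul_sum]
  refine Finset.sum_congr rfl fun i _ => ?_
  have h1 : (lambdaStar * len n j i * n⁻¹ ≤
      blockSq n (fun k => (Real.sqrt n)⁻¹ * (μ k + z k)) i) ↔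
      lambdaStar * len n j i ≤ blockSq n (fun k => μ k + z k) i := by
    rw [blockSq_scale hn0, mul_comm n⁻¹]
    exact mul_le_mul_iff_left₀ hi
  have hs : (Real.sqrt n)⁻¹ ^ 2 = n⁻¹ := by rw [inv_pow, Real.sq_sqrt hn0.le]
  split_ifs with h
  · rw [blockSq, Finset.mul_sum]
    refine Finset.sum_congr rfl fun k hk => ?_
    rw [blockEst, mem_block.1 hk, if_pos (h1.2 h), ← hs]
    ring
  · rw [blockSq, Finset.mul_sum]
    refine Finset.sum_congr rfl fun k hk => ?_
    rw [blockEst, mem_block.1 hk, if_neg (fun h' => h (h1.1 h')), ← hs]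
    ring

end Scaling

/-! ### Coverage -/

/-- The loss over one block against its share of the squared radius. `Ξ`, `X`, `T` are the
energies of the mean, the noise and the observations, and `c` is the inner product of mean and
noise. A block that is thresholded away has `Ξ ≤ 4 λ l`, so the restriction of the cross term
to such blocks does not depend on the noise. -/
theorem block_loss_le {l T X Ξ c : ℝ} (hT : T = Ξ + 2 * c + X) (hΞ : Ξ ≤ 2 * T + 2 * X)
    (hne : T ≠ lambdaStar * l) (hX : X ≤ lambdaStar * l)
    (hc : Ξ ≤ 4 * lambdaStar * l → c ≤ 4 * Real.sqrt lambdaStar * l) (hl : 0 ≤ l) :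
    (if lambdaStar * l ≤ T then X else Ξ) ≤
      (if T ≤ lambdaStar * l then T - l else 0)
      + (2 * lambdaStar + 8 * Real.sqrt lambdaStar - 1) * (if lambdaStar * l < T then l else 0)
      - (X - l) + 2 * (if Ξ ≤ 4 * lambdaStar * l then -c else 0) := by
  rcases lt_or_gt_of_ne hne with h | h
  · rw [if_neg (not_le.2 h), if_pos h.le, if_neg (not_lt.2 h.le), if_pos (by linarith)]
    linarith
  · rw [if_pos h.le, if_neg (not_le.2 h), if_pos h]
    have h8 : 0 ≤ Real.sqrt lambdaStar * l := mul_nonneg (Real.sqrt_nonneg _) hl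
    split_ifs with h4
    · have := hc h4
      nlinarith
    · nlinarith

theorem exp_neg_two_mul_len_le {n : ℝ} (hn : 1 < n) {j i : ℕ} (hi : i < numBlocks n j) :
    Real.exp (-(2 * len n j i)) ≤ (n ^ 2)⁻¹ := by
  have h1 := (log_le_blockLen n).trans (blockLen_le_len hi)
  have hn0 : 0 < n := by linarith
  rw [← Real.exp_log (show 0 < (n ^ 2)⁻¹ by positivity), Real.log_inv, Real.log_pow]
  apply Real.exp_le_exp.2
  push_cast
  linarith

theorem numBlocks_mul_le {n : ℝ} (hn : 1 < n) {j : ℕ} (hm : (2 : ℝ) ^ j ≤ n ^ 2) :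
    numBlocks n j * (n ^ 2)⁻¹ ≤ 1 / Real.log n := by
  have hn0 : 0 < n := by linarith
  have hlog := Real.log_pos hn
  have h1 : (numBlocks n j : ℝ) * blockLen n ≤ (2 : ℝ) ^ j := by
    exact_mod_cast Nat.div_mul_le_self (2 ^ j) (blockLen n)
  have h2 : (numBlocks n j : ℝ) * Real.log n ≤ numBlocks n j * blockLen n :=
    mul_le_mul_of_nonneg_left (log_le_blockLen n) (Nat.cast_nonneg _)
  rw [← div_eq_mul_inv, div_le_div_iff₀ (by positivity) hlog]
  linarith

theorem measureReal_lambdaStar_le {ι : Type*} [Fintype ι] (s : Finset ι) :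
    (stdNormal ι).real {z | lambdaStar * s.card ≤ ∑ k ∈ s, z k ^ 2} ≤
      Real.exp (-(2 * s.card)) := by
  refine (measureReal_sum_sq_ge_le lambdaStar_spec.1.le _ s).trans_eq ?_
  have hl := lambdaStar_pos.ne'
  have h : Real.log lambdaStar = lambdaStar - 5 := by linarith [lambdaStar_spec.2]
  rw [h]
  congr 1
  field_simp
  ring

theorem measureReal_biUnion_range_le {Ω : Type*} [MeasurableSpace Ω] (P : Measure Ω)
    (N : ℕ) (ε : ℝ) (E : ℕ → Set Ω) (hE : ∀ i < N, P.real (E i) ≤ ε) :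
    P.real (⋃ i ∈ Finset.range N, E i) ≤ N * ε := by
  refine (measureReal_biUnion_finset_le _ _).trans ?_
  refine (Finset.sum_le_card_nsmul _ _ ε fun i hi => hE i (Finset.mem_range.1 hi)).trans_eq ?_
  simp

theorem two_rpow_half_sq (j : ℕ) : ((2 : ℝ) ^ ((j : ℝ) / 2)) ^ 2 = (2 : ℝ) ^ j := by
  rw [← Real.rpow_natCast, ← Real.rpow_mul (by norm_num)]
  norm_num

theorem sqrt_two_pow (j : ℕ) : Real.sqrt ((2 : ℝ) ^ j) = (2 : ℝ) ^ ((j : ℝ) / 2) := by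
  rw [← two_rpow_half_sq, Real.sqrt_sq (by positivity)]

/-- For noise of unit variance, a set that contains every noise vector for which the loss is at
most the squared radius has a complement of probability at most `α + 2 / log n`. -/
theorem measureReal_compl_le_of_loss_le {n α : ℝ} (hn : 1 < n) (h0 : 0 < α) (h1 : α < 1) {j : ℕ}
    (hj : Real.log n ≤ (2 : ℝ) ^ j) (hm : (2 : ℝ) ^ j ≤ n ^ 2) (μ : Fin (2 ^ j) → ℝ)
    {S : Set (Fin (2 ^ j) → ℝ)}
    (hS : ∀ z, (∑ i ∈ Finset.range (numBlocks n j),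
        if lambdaStar * len n j i ≤ blockSq n (fun k => μ k + z k) i
          then blockSq n z i else blockSq n μ i) ≤
      unitRadiusSq n α (fun k => μ k + z k) → z ∈ S) :
    (stdNormal (Fin (2 ^ j))).real Sᶜ ≤ α + 2 / Real.log n := by
  classical
  set P := stdNormal (Fin (2 ^ j)) with hP
  set N := numBlocks n j with hN
  set w : ℝ := (2 : ℝ) ^ ((j : ℝ) / 2) with hw
  have hw0 : 0 ≤ w := by positivity
  have hw2 : w ^ 2 = (2 : ℝ) ^ j := two_rpow_half_sq j
  have hsl := Real.sqrt_nonneg lambdaStar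
  have hsl2 : Real.sqrt lambdaStar ^ 2 = lambdaStar := Real.sq_sqrt lambdaStar_pos.le
  have hlog : 0 < Real.log (2 / α) := Real.log_pos (by rw [lt_div_iff₀ h0]; linarith)
  -- the blocks of small mean, and the coefficients of the cross term over these blocks
  let a : Fin (2 ^ j) → ℝ := fun k =>
    if blockSq n μ (blockIndex n k) ≤ 4 * lambdaStar * len n j (blockIndex n k) then -μ k else 0
  have ha_sum : ∀ z : Fin (2 ^ j) → ℝ, ∑ k, a k * z k = ∑ i ∈ Finset.range N,
      if blockSq n μ i ≤ 4 * lambdaStar * len n j i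
        then -∑ k ∈ block n j i, μ k * z k else 0 := by
    intro z
    rw [← sum_blocks hn hj]
    refine Finset.sum_congr rfl fun i _ => ?_
    rw [← Finset.sum_neg_distrib]
    split_ifs with h
    · refine Finset.sum_congr rfl fun k hk => ?_
      simp only [a, mem_block.1 hk, if_pos h]
      ring
    · refine Finset.sum_eq_zero fun k hk => ?_
      simp only [a, mem_block.1 hk, if_neg h, zero_mul]
  have ha_sq : ∑ k, a k ^ 2 ≤ (2 * Real.sqrt lambdaStar * w) ^ 2 := by
    rw [← sum_blocks hn hj]
    have e : (2 * Real.sqrt lambdaStar * w) ^ 2 =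
        ∑ i ∈ Finset.range N, 4 * lambdaStar * len n j i := by
      rw [← Finset.mul_sum, sum_len hn hj, mul_pow, mul_pow, hsl2, hw2]
      norm_num
    rw [e]
    refine Finset.sum_le_sum fun i hi => ?_
    by_cases h : blockSq n μ i ≤ 4 * lambdaStar * len n j i
    · refine le_trans (le_of_eq ?_) h
      refine Finset.sum_congr rfl fun k hk => ?_
      simp only [a, mem_block.1 hk, if_pos h, neg_sq]
    · have hl := (len_pos hn (Finset.mem_range.1 hi)).le
      have := lambdaStar_pos
      refine le_trans (le_of_eq (Finset.sum_eq_zero fun k hk => ?_)) (by positivity)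
      simp only [a, mem_block.1 hk, if_neg h]
      norm_num
  -- the exceptional events
  let E₁ : ℕ → Set (Fin (2 ^ j) → ℝ) := fun i => {z | lambdaStar * len n j i ≤ blockSq n z i}
  let E₂ : ℕ → Set (Fin (2 ^ j) → ℝ) := fun i =>
    {z | blockSq n μ i ≤ 4 * lambdaStar * len n j i ∧
      4 * Real.sqrt lambdaStar * len n j i ≤ ∑ k ∈ block n j i, μ k * z k}
  let E₃ : Set (Fin (2 ^ j) → ℝ) := {z | ∑ k, z k ^ 2 ≤ (Fintype.card (Fin (2 ^ j)) : ℝ)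
    - 2 * Real.sqrt ((Fintype.card (Fin (2 ^ j)) : ℝ) * Real.log (2 / α))}
  let E₄ : Set (Fin (2 ^ j) → ℝ) :=
    {z | 2 * Real.sqrt lambdaStar * w * zUpper (α / 2) < ∑ k, a k * z k}
  let E₅ : ℕ → Set (Fin (2 ^ j) → ℝ) := fun i =>
    {z | blockSq n (fun k => μ k + z k) i = lambdaStar * len n j i}
  have p₁ : P.real (⋃ i ∈ Finset.range N, E₁ i) ≤ N * (n ^ 2)⁻¹ :=
    measureReal_biUnion_range_le P N _ E₁ fun i hi =>
      (measureReal_lambdaStar_le (block n j i)).trans (exp_neg_two_mul_len_le hn hi)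
  have p₂ : P.real (⋃ i ∈ Finset.range N, E₂ i) ≤ N * (n ^ 2)⁻¹ := by
    refine measureReal_biUnion_range_le P N _ E₂ fun i hi => ?_
    have hl := len_pos hn hi
    have hla := lambdaStar_pos
    by_cases h : blockSq n μ i ≤ 4 * lambdaStar * len n j i
    · refine ((measureReal_mono fun z hz => hz.2).trans
        (measureReal_sum_mul_ge_le μ (block n j i)
          (x := 4 * Real.sqrt lambdaStar * len n j i) (by positivity) (by positivity) h)).trans
        (le_trans (le_of_eq ?_) (exp_neg_two_mul_len_le hn hi))
      congr 1
      rw [mul_pow, mul_pow, hsl2]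
      field_simp
      norm_num
    · have : E₂ i = ∅ := Set.eq_empty_of_forall_notMem fun z hz => h hz.1
      rw [this, measureReal_empty]
      positivity
  have p₃ : P.real E₃ ≤ α / 2 := by
    refine (measureReal_sum_sq_le_le hlog.le).trans_eq ?_
    rw [Real.exp_neg, Real.exp_log (by positivity), inv_div]
  have p₄ : P.real E₄ ≤ α / 2 :=
    measureReal_sum_mul_gt_le a Finset.univ (by positivity) ha_sq (by linarith) (by linarith)
  have p₅ : P.real (⋃ i ∈ Finset.range N, E₅ i) ≤ N * 0 :=
    measureReal_biUnion_range_le P N _ E₅ fun i hi => by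
      have := measure_sum_sq_eq μ (block_nonempty hn hi) (lambdaStar * len n j i)
      exact ((measureReal_eq_zero_iff (measure_ne_top _ _)).2 this).le
  have hsub : Sᶜ ⊆ (⋃ i ∈ Finset.range N, E₁ i) ∪ (⋃ i ∈ Finset.range N, E₂ i) ∪ E₃ ∪ E₄ ∪
      (⋃ i ∈ Finset.range N, E₅ i) := by
    intro z hz
    by_contra hbad
    simp only [Set.mem_union, not_or, Set.mem_iUnion, not_exists] at hbad
    obtain ⟨⟨⟨⟨b₁, b₂⟩, b₃⟩, b₄⟩, b₅⟩ := hbad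
    refine hz (hS z ?_)
    have hblock : ∀ i ∈ Finset.range N,
        (if lambdaStar * len n j i ≤ blockSq n (fun k => μ k + z k) i
          then blockSq n z i else blockSq n μ i) ≤
        (if blockSq n (fun k => μ k + z k) i ≤ lambdaStar * len n j i
          then blockSq n (fun k => μ k + z k) i - len n j i else 0)
        + (2 * lambdaStar + 8 * Real.sqrt lambdaStar - 1) *
          (if lambdaStar * len n j i < blockSq n (fun k => μ k + z k) i then len n j i else 0)
        - (blockSq n z i - len n j i)
        + 2 * (if blockSq n μ i ≤ 4 * lambdaStar * len n j i
          then -∑ k ∈ block n j i, μ k * z k else 0) := by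
      intro i hi
      refine block_loss_le (blockSq_add μ z i) ?_ (b₅ i hi) (not_le.1 (b₁ i hi)).le
        (fun h => ?_) (len_pos hn (Finset.mem_range.1 hi)).le
      · simp only [blockSq, Finset.mul_sum, ← Finset.sum_add_distrib]
        refine Finset.sum_le_sum fun k _ => ?_
        nlinarith [sq_nonneg (μ k + z k + z k)]
      · by_contra hlt
        exact b₂ i hi ⟨h, (not_le.1 hlt).le⟩
    refine (Finset.sum_le_sum hblock).trans ?_
    unfold unitRadiusSq killedExcess keptLength
    rw [Finset.sum_add_distrib, Finset.sum_sub_distrib, Finset.sum_add_distrib,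
      Finset.sum_sub_distrib, ← Finset.mul_sum, ← Finset.mul_sum, ← ha_sum z,
      sum_blockSq hn hj, sum_len hn hj]
    have c₃ : (Fintype.card (Fin (2 ^ j)) : ℝ)
      - 2 * Real.sqrt ((Fintype.card (Fin (2 ^ j)) : ℝ) * Real.log (2 / α)) < ∑ k, z k ^ 2 :=
      not_le.1 b₃
    have c₄ : ∑ k, a k * z k ≤ 2 * Real.sqrt lambdaStar * w * zUpper (α / 2) := not_lt.1 b₄
    rw [Fintype.card_fin, Nat.cast_pow, Nat.cast_ofNat, Real.sqrt_mul (by positivity),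
      sqrt_two_pow, ← hw] at c₃
    have c₅ := le_max_right 0 (∑ i ∈ Finset.range N,
      if blockSq n (fun k => μ k + z k) i ≤ lambdaStar * len n j i
        then blockSq n (fun k => μ k + z k) i - len n j i else 0)
    linarith
  have hU : P.real Sᶜ ≤ N * (n ^ 2)⁻¹ + N * (n ^ 2)⁻¹ + α / 2 + α / 2 + N * 0 := by
    refine (measureReal_mono hsub).trans ?_
    refine (measureReal_union_le _ _).trans (add_le_add ?_ p₅)
    refine (measureReal_union_le _ _).trans (add_le_add ?_ p₄)
    refine (measureReal_union_le _ _).trans (add_le_add ?_ p₃)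
    exact (measureReal_union_le _ _).trans (add_le_add p₁ p₂)
  have hN' := numBlocks_mul_le hn hm
  have h2 : 2 / Real.log n = 1 / Real.log n + 1 / Real.log n := by ring
  rw [← hN] at hN'
  linarith

instance (J : ℕ) : IsProbabilityMeasure (noise J) := by
  unfold noise
  infer_instance

instance (m : ℕ) : IsProbabilityMeasure (chiSqLaw m) :=
  Measure.isProbabilityMeasure_map (Measurable.aemeasurable (by fun_prop))

theorem measurePreserving_level {J : ℕ} (j : Fin J) :
    MeasurePreserving (fun z : Coeffs J => z j) (noise J) (stdNormal (Fin (2 ^ (j : ℕ)))) :=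
  measurePreserving_eval (fun j : Fin J => stdNormal (Fin (2 ^ (j : ℕ)))) j

theorem one_sub_le_measureReal_level {J : ℕ} (j : Fin J) {S : Set (Fin (2 ^ (j : ℕ)) → ℝ)} {ε : ℝ}
    (hS : (stdNormal (Fin (2 ^ (j : ℕ)))).real Sᶜ ≤ ε) :
    1 - ε ≤ (noise J).real {z | z j ∈ S} := by
  have hp := measurePreserving_level j
  have h1 : (noise J).real {z : Coeffs J | z j ∈ S}ᶜ ≤ ε := by
    refine le_trans (ENNReal.toReal_mono (measure_ne_top _ _) ?_) hS
    rw [← hp.map_eq]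
    exact Measure.le_map_apply hp.aemeasurable Sᶜ
  have h := measureReal_union_le (μ := noise J) {z : Coeffs J | z j ∈ S} {z : Coeffs J | z j ∈ S}ᶜ
  rw [Set.union_compl_self, probReal_univ] at h
  linarith

theorem mem_confBall_of_sum_sq_le {n α : ℝ} {j : ℕ} {y v : Fin (2 ^ j) → ℝ} {r : ℝ}
    (hr : radius n α y = Real.sqrt r) (h : ∑ k, (v k - center n y k) ^ 2 ≤ r) :
    v ∈ confBall n α y := by
  change ‖WithLp.toLp 2 (v - center n y)‖ ≤ radius n α y
  rw [hr, PiLp.norm_eq_of_L2]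
  refine Real.sqrt_le_sqrt (le_of_eq_of_le ?_ h)
  exact Finset.sum_congr rfl fun k _ => by simp

theorem measureReal_quantile_chiSqLaw_lt {α : ℝ} (h0 : 0 < α) (h1 : α < 1) (m : ℕ) :
    (stdNormal (Fin m)).real {z | quantile (chiSqLaw m) (1 - α) < ∑ k, z k ^ 2} ≤ α := by
  have h := le_measureReal_Iic_quantile (chiSqLaw m) (u := 1 - α) (by linarith) (by linarith)
  have h2 := probReal_compl_eq_one_sub (μ := chiSqLaw m)
    (s := Set.Iic (quantile (chiSqLaw m) (1 - α))) measurableSet_Iic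
  rw [Set.compl_Iic] at h2
  have h3 : (chiSqLaw m).real (Set.Ioi (quantile (chiSqLaw m) (1 - α))) ≤ α := by linarith
  rw [chiSqLaw, map_measureReal_apply (by fun_prop) measurableSet_Ioi] at h3
  exact h3

theorem measureReal_confBall_compl_le {n α : ℝ} (hn : 1 < n) (h0 : 0 < α) (h1 : α < 1) {j : ℕ}
    (hm : (2 : ℝ) ^ j ≤ n ^ 2) (μ : Fin (2 ^ j) → ℝ) :
    (stdNormal (Fin (2 ^ j))).real {z | (fun k => (Real.sqrt n)⁻¹ * μ k) ∈
      confBall n α (fun k => (Real.sqrt n)⁻¹ * (μ k + z k))}ᶜ ≤ α + 2 / Real.log n := by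
  have hn0 : 0 < n := by linarith
  have hi : 0 < n⁻¹ := inv_pos.2 hn0
  have hlog := Real.log_pos hn
  by_cases hj : Real.log n ≤ (2 : ℝ) ^ j
  · apply measureReal_compl_le_of_loss_le hn h0 h1 hj hm μ
    intro z hz
    rw [Set.mem_ofPred_eq]
    refine mem_confBall_of_sum_sq_le
      (r := blockRadiusSq n α fun k => (Real.sqrt n)⁻¹ * (μ k + z k)) ?_ ?_
    · rw [radius, if_pos hj]
    rw [blockRadiusSq_scale hn0, center, if_pos hj, sum_sub_blockEst_sq hn hj]
    exact mul_le_mul_of_nonneg_left hz hi.le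
  · refine le_trans ((measureReal_mono fun z hz => ?_).trans
      (measureReal_quantile_chiSqLaw_lt h0 h1 (2 ^ j))) (by
        have : 0 < 2 / Real.log n := by positivity
        linarith)
    by_contra hle
    rw [Set.mem_compl_iff, Set.mem_ofPred_eq] at hz
    rw [Set.mem_ofPred_eq, not_lt] at hle
    refine hz (mem_confBall_of_sum_sq_le
      (r := quantile (chiSqLaw (2 ^ j)) (1 - α) * n⁻¹) ?_ ?_)
    · rw [radius, if_neg hj]
    rw [center, if_neg hj, mul_comm]
    refine le_trans (le_of_eq ?_) (mul_le_mul_of_nonneg_left hle hi.le)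
    rw [Finset.mul_sum]
    refine Finset.sum_congr rfl fun k _ => ?_
    rw [← mul_sub, mul_pow, inv_pow, Real.sq_sqrt hn0.le]
    ring

theorem one_sub_le_measureReal_mem_confBall {n α : ℝ} (hn : 1 < n) (h0 : 0 < α) (h1 : α < 1)
    {J : ℕ} (j : Fin J) (hm : (2 : ℝ) ^ (j : ℕ) ≤ n ^ 2) (θ : Coeffs J) :
    1 - α - 2 / Real.log n ≤ (noise J).real {z | θ j ∈ confBall n α (obs n θ z j)} := by
  have hn0 : 0 < n := by linarith
  have hs0 : Real.sqrt n ≠ 0 := (Real.sqrt_pos.2 hn0).ne'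
  have hθ : (fun k => (Real.sqrt n)⁻¹ * (Real.sqrt n * θ j k)) = θ j := by
    funext k
    field_simp
  have h := one_sub_le_measureReal_level j
    (measureReal_confBall_compl_le hn h0 h1 hm fun k => Real.sqrt n * θ j k)
  rw [hθ, ← sub_sub] at h
  simp only [obs_eq hn0]
  exact h

/-! ### Moments of the noncentral chi-squared excess -/

theorem integrable_poly_gaussianReal (a b c d e : ℝ) :
    Integrable (fun x : ℝ => a + b * x + c * x ^ 2 + d * x ^ 3 + e * x ^ 4) (gaussianReal 0 1) := by
  have h1 : Integrable (fun x : ℝ => x) (gaussianReal 0 1) := by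
    simpa only [pow_one] using integrable_pow_gaussianReal 1
  exact ((((integrable_const a).add (h1.const_mul b)).add
    ((integrable_pow_gaussianReal 2).const_mul c)).add
    ((integrable_pow_gaussianReal 3).const_mul d)).add ((integrable_pow_gaussianReal 4).const_mul e)

theorem integral_poly_gaussianReal (a b c d e : ℝ) :
    ∫ x, (a + b * x + c * x ^ 2 + d * x ^ 3 + e * x ^ 4) ∂gaussianReal 0 1 = a + c + 3 * e := by
  have i1 : Integrable (fun x : ℝ => x) (gaussianReal 0 1) := by
    simpa only [pow_one] using integrable_pow_gaussianReal 1
  have i2 := integrable_pow_gaussianReal 2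
  have i3 := integrable_pow_gaussianReal 3
  have i4 := integrable_pow_gaussianReal 4
  have m1 : ∫ x, x ∂gaussianReal 0 1 = 0 := by
    simpa only [pow_one] using integral_odd_pow_gaussianReal (n := 1) (by decide)
  have m2 : ∫ x, x ^ 2 ∂gaussianReal 0 1 = 1 := by
    simpa using integral_even_pow_gaussianReal 1
  have m3 : ∫ x, x ^ 3 ∂gaussianReal 0 1 = 0 := integral_odd_pow_gaussianReal (by decide)
  have m4 : ∫ x, x ^ 4 ∂gaussianReal 0 1 = 3 := by
    have h := integral_even_pow_gaussianReal 2
    norm_num [Nat.doubleFactorial] at h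
    exact h
  have j1 := (integrable_const a).add (i1.const_mul b)
  have j2 := j1.add (i2.const_mul c)
  have j3 := j2.add (i3.const_mul d)
  have k1 := integral_add (integrable_const a) (i1.const_mul b)
  have k2 := integral_add j1 (i2.const_mul c)
  have k3 := integral_add j2 (i3.const_mul d)
  have k4 := integral_add j3 (i4.const_mul e)
  simp only [Pi.add_apply] at k2 k3 k4
  have k0 : ∫ x, b * x ∂gaussianReal 0 1 = b * ∫ x, x ∂gaussianReal 0 1 := integral_const_mul b _
  rw [k4, k3, k2, k1, k0, m1]
  simp only [integral_const_mul, m2, m3, m4, integral_const, probReal_univ, smul_eq_mul]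
  ring

section Excess

variable {ι : Type*} [Fintype ι] (μ : ι → ℝ)

/-- The centred excess energy `∑ (μ + z)² - ∑ μ² - m` of a noisy vector. -/
def excess (z : ι → ℝ) : ℝ := ∑ k, (2 * μ k * z k + z k ^ 2 - 1)

theorem memLp_excess_coord (c : ℝ) :
    MemLp (fun x : ℝ => 2 * c * x + x ^ 2 - 1) 2 (gaussianReal 0 1) := by
  rw [memLp_two_iff_integrable_sq (by fun_prop)]
  refine (integrable_poly_gaussianReal 1 (-4 * c) (4 * c ^ 2 - 2) (4 * c) 1).congr
    (Filter.Eventually.of_forall fun x => ?_)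
  simp only
  ring

theorem integral_excess_coord (c : ℝ) :
    ∫ x, (2 * c * x + x ^ 2 - 1) ∂gaussianReal 0 1 = 0 := by
  have h := integral_poly_gaussianReal (-1) (2 * c) 1 0 0
  norm_num at h
  refine Eq.trans (integral_congr_ae (Filter.Eventually.of_forall fun x => ?_)) h
  simp only
  ring

theorem variance_excess_coord (c : ℝ) :
    Var[fun x : ℝ => 2 * c * x + x ^ 2 - 1; gaussianReal 0 1] = 4 * c ^ 2 + 2 := by
  rw [variance_eq_sub (memLp_excess_coord c), integral_excess_coord]
  have h := integral_poly_gaussianReal 1 (-4 * c) (4 * c ^ 2 - 2) (4 * c) 1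
  have e : (1 : ℝ) + (4 * c ^ 2 - 2) + 3 * 1 = 4 * c ^ 2 + 2 := by ring
  rw [e] at h
  rw [← h, zero_pow two_ne_zero, sub_zero]
  refine integral_congr_ae (Filter.Eventually.of_forall fun x => ?_)
  simp only [Pi.pow_apply]
  ring

theorem memLp_excess : MemLp (excess μ) 2 (stdNormal ι) :=
  memLp_finsetSum _ fun k _ => (memLp_excess_coord (μ k)).comp_measurePreserving
    (measurePreserving_eval (fun _ : ι => gaussianReal 0 1) k)

theorem integral_excess : ∫ z, excess μ z ∂stdNormal ι = 0 := by
  unfold excess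
  rw [integral_finsetSum _ fun k _ => integrable_comp_eval
    (μ := fun _ : ι => gaussianReal 0 1) (f := fun x : ℝ => 2 * μ k * x + x ^ 2 - 1)
    ((memLp_excess_coord (μ k)).integrable one_le_two)]
  refine Finset.sum_eq_zero fun k _ => ?_
  refine Eq.trans ?_ (integral_excess_coord (μ k))
  exact integral_comp_eval (i := k) (μ := fun _ : ι => gaussianReal 0 1)
    (f := fun x : ℝ => 2 * μ k * x + x ^ 2 - 1) (by fun_prop)

theorem integral_excess_sq :
    ∫ z, excess μ z ^ 2 ∂stdNormal ι = 4 * ∑ k, μ k ^ 2 + 2 * Fintype.card ι := by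
  have h := variance_sum_pi (μ := fun _ : ι => gaussianReal 0 1)
    (X := fun k (x : ℝ) => 2 * μ k * x + x ^ 2 - 1) (fun k => memLp_excess_coord (μ k))
  have e : (∑ k, fun z : ι → ℝ => 2 * μ k * z k + z k ^ 2 - 1) = excess μ := by
    ext z
    simp [excess]
  rw [e, variance_eq_sub (memLp_excess μ), integral_excess] at h
  simp only [variance_excess_coord, Finset.sum_add_distrib, ← Finset.mul_sum, Finset.sum_const,
    Finset.card_univ, nsmul_eq_mul, Pi.pow_apply] at h
  linarith

theorem sum_add_sq_sub_one (z : ι → ℝ) :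
    ∑ k, (μ k + z k) ^ 2 - Fintype.card ι = ∑ k, μ k ^ 2 + excess μ z := by
  have h : (Fintype.card ι : ℝ) = ∑ _k : ι, (1 : ℝ) := by simp
  rw [excess, h, ← Finset.sum_sub_distrib, ← Finset.sum_add_distrib]
  exact Finset.sum_congr rfl fun k _ => by ring

end Excess

/-! ### Tail bounds for short and long blocks -/

theorem exp_two_bounds : 7.389 < Real.exp 2 ∧ Real.exp 2 < 7.3891 := by
  have h1 := Real.exp_one_gt_d9
  have h2 := Real.exp_one_lt_d9
  have e : Real.exp 2 = Real.exp 1 ^ 2 := by rw [← Real.exp_nat_mul]; norm_num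
  rw [e]
  constructor <;> nlinarith

theorem lambdaStar_bounds : 6.93 ≤ lambdaStar ∧ lambdaStar ≤ 6.95 := by
  obtain ⟨h1, h5⟩ := lambdaStar_spec
  obtain ⟨b1, b2⟩ := exp_two_bounds
  -- the increment of `x - log x` over `[a, b] ⊆ [1, ∞)` is `(b - a) - log (b / a) > 0`
  have hmono : ∀ a b : ℝ, 1 < a → a < b → a - Real.log a < b - Real.log b := by
    intro a b ha hab
    have ha0 : 0 < a := by linarith
    have hlog : Real.log b - Real.log a ≤ b / a - 1 := by
      rw [← Real.log_div (by linarith) (by linarith)]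
      exact Real.log_le_sub_one_of_pos (by apply div_pos <;> linarith)
    have hba : b / a - 1 < b - a := by
      rw [div_sub_one (by linarith), div_lt_iff₀ ha0]
      nlinarith
    linarith
  constructor
  · by_contra hlt
    have h := hmono _ _ h1 (not_le.1 hlt)
    have hl : (1.93 : ℝ) ≤ Real.log 6.93 := by
      rw [Real.le_log_iff_exp_le (by norm_num), show (1.93 : ℝ) = 2 - 0.07 by norm_num,
        Real.exp_sub, div_le_iff₀ (Real.exp_pos _)]
      have := Real.add_one_le_exp (0.07 : ℝ)
      nlinarith
    linarith
  · by_contra hlt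
    have h := hmono 6.95 _ (by norm_num) (not_le.1 hlt)
    have hl : Real.log 6.95 ≤ 1.95 := by
      rw [Real.log_le_iff_le_exp (by norm_num), show (1.95 : ℝ) = 2 + -0.05 by norm_num,
        Real.exp_add]
      have := Real.add_one_le_exp (-0.05 : ℝ)
      nlinarith
    linarith

section Tails

variable {ι : Type*} [Fintype ι]

theorem measureReal_sum_sq_ge_le_exp (s : Finset ι) :
    (stdNormal ι).real {z | 6.9 * s.card ≤ ∑ k ∈ s, z k ^ 2} ≤ Real.exp (-(1.9 * s.card)) := by
  refine (measureReal_sum_sq_ge_le (c := 7) (by norm_num) _ s).trans ?_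
  have h7 : Real.log 7 ≤ 2 := by
    rw [Real.log_le_iff_le_exp (by norm_num)]
    linarith [exp_two_bounds.1]
  apply Real.exp_le_exp.2
  have hs : (0 : ℝ) ≤ s.card := Nat.cast_nonneg _
  nlinarith

/-- For a block of length one the sixth moment does better than the exponential moments. -/
theorem measureReal_sum_sq_ge_le_of_card_eq_one {s : Finset ι} (hs : s.card = 1) :
    (stdNormal ι).real {z | 6.9 * s.card ≤ ∑ k ∈ s, z k ^ 2} ≤ 15 / 6.9 ^ 3 := by
  obtain ⟨i, rfl⟩ := Finset.card_eq_one.1 hs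
  have hint : Integrable (fun z : ι → ℝ => z i ^ 6) (stdNormal ι) :=
    integrable_comp_eval (μ := fun _ : ι => gaussianReal 0 1) (f := fun x : ℝ => x ^ 6)
      (integrable_pow_gaussianReal 6)
  have h15 : ∫ z : ι → ℝ, z i ^ 6 ∂stdNormal ι = 15 := by
    have h := integral_even_pow_gaussianReal 3
    norm_num [Nat.doubleFactorial] at h
    rw [← h]
    exact integral_comp_eval (μ := fun _ : ι => gaussianReal 0 1) (f := fun x : ℝ => x ^ 6)
      (by fun_prop)
  have hM := mul_meas_ge_le_integral_of_nonneg (μ := stdNormal ι)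
    (f := fun z : ι → ℝ => z i ^ 6) (Filter.Eventually.of_forall fun z => by positivity) hint
    (6.9 ^ 3)
  rw [h15] at hM
  rw [le_div_iff₀ (by norm_num), mul_comm]
  refine le_trans (mul_le_mul_of_nonneg_left (measureReal_mono fun z hz => ?_) (by norm_num)) hM
  simp only [Finset.sum_singleton, Finset.card_singleton, Nat.cast_one, mul_one,
    Set.mem_ofPred_eq] at hz ⊢
  calc (6.9 : ℝ) ^ 3 ≤ (z i ^ 2) ^ 3 := pow_le_pow_left₀ (by norm_num) hz 3
    _ = z i ^ 6 := by ring

/-- For a block of length two, Markov's inequality for `exp (2 / 5 * χ²) - 1`. -/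
theorem measureReal_sum_sq_ge_le_of_card_eq_two {s : Finset ι} (hs : s.card = 2) :
    (stdNormal ι).real {z | 6.9 * s.card ≤ ∑ k ∈ s, z k ^ 2} ≤ 4 / 242 := by
  have hint := integrable_exp_mul_sum_sq (ι := ι) (t := 2 / 5) (by norm_num) s
  have hmgf := mgf_sum_sq (ι := ι) (t := 2 / 5) (by norm_num) s
  rw [hs, inv_pow, Real.sq_sqrt (by norm_num), mgf] at hmgf
  have h4 : ∫ z : ι → ℝ, (Real.exp (2 / 5 * ∑ k ∈ s, z k ^ 2) - 1) ∂stdNormal ι = 4 := by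
    rw [integral_sub hint (integrable_const _), hmgf]
    simp
    norm_num
  have hM := mul_meas_ge_le_integral_of_nonneg (μ := stdNormal ι)
    (f := fun z : ι → ℝ => Real.exp (2 / 5 * ∑ k ∈ s, z k ^ 2) - 1)
    (Filter.Eventually.of_forall fun z => by
      have h0 : 0 ≤ 2 / 5 * ∑ k ∈ s, z k ^ 2 :=
        mul_nonneg (by norm_num) (Finset.sum_nonneg fun _ _ => sq_nonneg _)
      simpa using Real.one_le_exp h0) (hint.sub (integrable_const _)) 242
  rw [h4] at hM
  rw [le_div_iff₀ (by norm_num), mul_comm]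
  refine le_trans (mul_le_mul_of_nonneg_left (measureReal_mono fun z hz => ?_) (by norm_num)) hM
  simp only [hs, Set.mem_ofPred_eq] at hz ⊢
  have h1 : Real.exp (5.52 : ℝ) ≤ Real.exp (2 / 5 * ∑ k ∈ s, z k ^ 2) := by
    apply Real.exp_le_exp.2
    push_cast at hz
    linarith
  have h2 : Real.exp (5.52 : ℝ) = Real.exp 1 ^ 5 * Real.exp 0.26 ^ 2 := by
    rw [← Real.exp_nat_mul, ← Real.exp_nat_mul, ← Real.exp_add]
    norm_num
  have h3 := Real.quadratic_le_exp_of_nonneg (x := 0.26) (by norm_num)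
  have h5 : (2.718 : ℝ) ≤ Real.exp 1 := by linarith [Real.exp_one_gt_d9]
  have h6 : (1.29 : ℝ) ≤ Real.exp 0.26 := by linarith
  have h7 : (2.718 : ℝ) ^ 5 * 1.29 ^ 2 ≤ Real.exp 1 ^ 5 * Real.exp 0.26 ^ 2 := by gcongr
  have h8 : (243 : ℝ) ≤ 2.718 ^ 5 * 1.29 ^ 2 := by norm_num
  linarith

end Tails

/-! ### The expected squared radius -/

section Risk

variable {n : ℝ} {j : ℕ}

theorem two_rpow_half_le_of_le {a : ℕ} (h : j ≤ a) {b : ℝ} (hb : 0 ≤ b)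
    (hab : (2 : ℝ) ^ a ≤ b ^ 2) :
    (2 : ℝ) ^ ((j : ℝ) / 2) ≤ b := by
  rw [← sqrt_two_pow]
  exact Real.sqrt_le_iff.2 ⟨hb, (pow_le_pow_right₀ (by norm_num) h).trans hab⟩

theorem level_lt_of_log_le {L a : ℕ} (hn : 1 < n) (hm : (2 : ℝ) ^ j ≤ n ^ 2) (hL : Real.log n ≤ L)
    (ha : Real.exp 2 ^ L < 2 ^ a) : j < a := by
  have hn0 : 0 < n := by linarith
  have h1 : n ^ 2 ≤ Real.exp 2 ^ L := by
    rw [← Real.exp_nat_mul, ← Real.exp_log hn0, ← Real.exp_nat_mul]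
    apply Real.exp_le_exp.2
    push_cast
    linarith
  exact (pow_lt_pow_iff_right₀ (by norm_num : (1 : ℝ) < 2)).1 ((hm.trans h1).trans_lt ha)

/-- The noise exceeds `6.9` times the length of a block with probability small compared with
`2 ^ (-j / 2)`. The exponential bound suffices for `log n > 2`; the bound `2 ^ j ≤ n ^ 2` leaves
few levels for blocks of length one and two, where sharper tail bounds are used. -/
theorem measureReal_blockSq_ge_mul_le (hn : 1 < n)
    (hm : (2 : ℝ) ^ j ≤ n ^ 2) {i : ℕ} (hi : i < numBlocks n j) :
    (stdNormal (Fin (2 ^ j))).real {z | 6.9 * len n j i ≤ blockSq n z i} *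
      (2 : ℝ) ^ ((j : ℝ) / 2) ≤ 0.095 := by
  set w : ℝ := (2 : ℝ) ^ ((j : ℝ) / 2) with hw
  have hw0 : 0 ≤ w := by positivity
  have hL := blockLen_pos hn
  have hlog := log_le_blockLen n
  have hge := blockLen_le_card_block hi
  have hle := card_block_le (j := j) (i := i) hn
  have hexp := measureReal_sum_sq_ge_le_exp (block n j i)
  obtain ⟨e1, e2⟩ := exp_two_bounds
  change (stdNormal (Fin (2 ^ j))).real
    {z | 6.9 * ((block n j i).card : ℝ) ≤ ∑ k ∈ block n j i, z k ^ 2} * w ≤ 0.095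
  obtain hL1 | hL2 | hL3 : blockLen n = 1 ∨ blockLen n = 2 ∨ 3 ≤ blockLen n := by omega
  · rw [hL1] at hlog
    have hj : j < 3 := level_lt_of_log_le hn hm hlog (by norm_num; linarith)
    have hw2 : w ≤ 2 := two_rpow_half_le_of_le (a := 2) (by omega) (by norm_num) (by norm_num)
    have ht := measureReal_sum_sq_ge_le_of_card_eq_one (s := block n j i) (by omega)
    calc _ ≤ 15 / 6.9 ^ 3 * (2 : ℝ) := by gcongr
      _ ≤ 0.095 := by norm_num
  · rw [hL2] at hlog
    have hj : j < 6 := level_lt_of_log_le hn hm hlog (by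
      norm_num
      nlinarith)
    have hw2 : w ≤ 5.7 := two_rpow_half_le_of_le (a := 5) (by omega) (by norm_num) (by norm_num)
    obtain h2 | h3 : (block n j i).card = 2 ∨ (block n j i).card = 3 := by omega
    · have ht := measureReal_sum_sq_ge_le_of_card_eq_two (s := block n j i) h2
      calc _ ≤ 4 / 242 * (5.7 : ℝ) := by gcongr
        _ ≤ 0.095 := by norm_num
    · have ht : Real.exp (-(1.9 * (block n j i).card)) ≤ 1 / 60 := by
        rw [h3, Real.exp_neg, one_div]
        apply inv_anti₀ (by norm_num)
        have h5 : Real.exp 2 * Real.exp 2 * Real.exp 1 ≤ Real.exp (1.9 * (3 : ℕ)) := by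
          rw [← Real.exp_add, ← Real.exp_add]
          apply Real.exp_le_exp.2
          norm_num
        have h6 := Real.add_one_le_exp (1 : ℝ)
        have h7 : 7 * 7 * 2 ≤ Real.exp 2 * Real.exp 2 * Real.exp 1 := by
          gcongr <;> linarith
        linarith
      calc _ ≤ 1 / 60 * (5.7 : ℝ) := by
            gcongr
            exact hexp.trans ht
        _ ≤ 0.095 := by norm_num
  · have hn0 : 0 < n := by linarith
    set l : ℝ := ((block n j i).card : ℝ) with hl
    have hl3 : (3 : ℝ) ≤ l := by
      rw [hl]
      exact_mod_cast hL3.trans hge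
    have hwl : w ≤ Real.exp l := by
      have h1 : w ≤ n := by
        rw [hw, ← sqrt_two_pow]
        exact Real.sqrt_le_iff.2 ⟨hn0.le, hm⟩
      refine h1.trans ?_
      rw [← Real.log_le_iff_le_exp hn0]
      refine hlog.trans ?_
      rw [hl]
      exact_mod_cast hge
    have h12 : (10.6 : ℝ) ≤ Real.exp 2.7 := by
      have h5 : Real.exp 2.7 = Real.exp 2 * Real.exp 0.7 := by
        rw [← Real.exp_add]
        norm_num
      have h6 := Real.add_one_le_exp (0.7 : ℝ)
      rw [h5]
      nlinarith
    calc _ ≤ Real.exp (-(1.9 * l)) * Real.exp l := by gcongr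
      _ = Real.exp (-(0.9 * l)) := by
        rw [← Real.exp_add]
        congr 1
        ring
      _ ≤ Real.exp (-2.7) := by
        apply Real.exp_le_exp.2
        linarith
      _ = (Real.exp 2.7)⁻¹ := Real.exp_neg _
      _ ≤ 10.6⁻¹ := inv_anti₀ (by norm_num) h12
      _ ≤ 0.095 := by norm_num

theorem measurable_blockSq (i : ℕ) : Measurable fun x : Fin (2 ^ j) → ℝ => blockSq n x i := by
  unfold blockSq
  fun_prop

theorem measurable_blockSq_add (μ : Fin (2 ^ j) → ℝ) (i : ℕ) :
    Measurable fun z : Fin (2 ^ j) → ℝ => blockSq n (fun k => μ k + z k) i := by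
  unfold blockSq
  fun_prop

theorem blockSq_add_le (μ z : Fin (2 ^ j) → ℝ) (i : ℕ) :
    blockSq n (fun k => μ k + z k) i ≤ 1.001 * blockSq n z i + 1001 * blockSq n μ i := by
  simp only [blockSq, Finset.mul_sum, ← Finset.sum_add_distrib]
  refine Finset.sum_le_sum fun k _ => ?_
  nlinarith [sq_nonneg (z k - 1000 * μ k)]

theorem measurable_killedExcess (μ : Fin (2 ^ j) → ℝ) :
    Measurable fun z : Fin (2 ^ j) → ℝ => killedExcess n (fun k => μ k + z k) :=
  Finset.measurable_fun_sum _ fun i _ => Measurable.ite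
    (measurableSet_le (measurable_blockSq_add μ i) measurable_const)
    ((measurable_blockSq_add μ i).sub_const _) measurable_const

theorem measurable_ite_lt_blockSq (μ : Fin (2 ^ j) → ℝ) (i : ℕ) :
    Measurable fun z : Fin (2 ^ j) → ℝ =>
      if lambdaStar * len n j i < blockSq n (fun k => μ k + z k) i then len n j i else 0 :=
  Measurable.ite (measurableSet_lt measurable_const (measurable_blockSq_add μ i))
    measurable_const measurable_const

theorem measurable_keptLength (μ : Fin (2 ^ j) → ℝ) :
    Measurable fun z : Fin (2 ^ j) → ℝ => keptLength n (fun k => μ k + z k) :=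
  Finset.measurable_fun_sum _ fun i _ => measurable_ite_lt_blockSq μ i

theorem max_killedExcess_le (hn : 1 < n) (hj : Real.log n ≤ (2 : ℝ) ^ j) (x : Fin (2 ^ j) → ℝ) :
    max 0 (killedExcess n x) ≤ (lambdaStar - 1) * (2 : ℝ) ^ j := by
  have hl1 := lambdaStar_spec.1
  refine max_le (mul_nonneg (by linarith) (by positivity)) ?_
  rw [← sum_len hn hj, Finset.mul_sum]
  refine Finset.sum_le_sum fun i hi => ?_
  have hl := len_pos hn (Finset.mem_range.1 hi)
  split_ifs with h
  · linarith
  · exact mul_nonneg (by linarith) hl.le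

theorem keptLength_nonneg (x : Fin (2 ^ j) → ℝ) : 0 ≤ keptLength n x :=
  Finset.sum_nonneg fun i _ => by
    split_ifs
    · exact Nat.cast_nonneg _
    · exact le_rfl

theorem keptLength_le (hn : 1 < n) (hj : Real.log n ≤ (2 : ℝ) ^ j) (x : Fin (2 ^ j) → ℝ) :
    keptLength n x ≤ (2 : ℝ) ^ j := by
  rw [← sum_len hn hj]
  refine Finset.sum_le_sum fun i hi => ?_
  have hl := len_pos hn (Finset.mem_range.1 hi)
  split_ifs
  · exact le_rfl
  · exact hl.le

/-- The kept blocks have nonnegative excess because `λ > 1`. -/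
theorem killedExcess_le (hn : 1 < n) (hj : Real.log n ≤ (2 : ℝ) ^ j) (x : Fin (2 ^ j) → ℝ) :
    killedExcess n x ≤ ∑ k, x k ^ 2 - (2 : ℝ) ^ j := by
  rw [← sum_blockSq hn hj, ← sum_len hn hj, ← Finset.sum_sub_distrib]
  refine Finset.sum_le_sum fun i hi => ?_
  have hl := len_pos hn (Finset.mem_range.1 hi)
  have hl1 := lambdaStar_spec.1
  split_ifs with h
  · exact le_rfl
  · nlinarith

theorem integrable_max_killedExcess (hn : 1 < n) (hj : Real.log n ≤ (2 : ℝ) ^ j)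
    (μ : Fin (2 ^ j) → ℝ) :
    Integrable (fun z => max 0 (killedExcess n (fun k => μ k + z k)))
      (stdNormal (Fin (2 ^ j))) := by
  refine Integrable.of_bound (measurable_const.max (measurable_killedExcess μ)).aestronglyMeasurable
    ((lambdaStar - 1) * (2 : ℝ) ^ j) (Filter.Eventually.of_forall fun z => ?_)
  rw [Real.norm_of_nonneg (le_max_left _ _)]
  exact max_killedExcess_le hn hj _

theorem integrable_keptLength (hn : 1 < n) (hj : Real.log n ≤ (2 : ℝ) ^ j) (μ : Fin (2 ^ j) → ℝ) :
    Integrable (fun z => keptLength n (fun k => μ k + z k)) (stdNormal (Fin (2 ^ j))) := by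
  refine Integrable.of_bound (measurable_keptLength μ).aestronglyMeasurable
    ((2 : ℝ) ^ j) (Filter.Eventually.of_forall fun z => ?_)
  rw [Real.norm_of_nonneg (keptLength_nonneg _)]
  exact keptLength_le hn hj _

theorem integral_max_killedExcess_le (hn : 1 < n) (hj : Real.log n ≤ (2 : ℝ) ^ j)
    (μ : Fin (2 ^ j) → ℝ) :
    ∫ z, max 0 (killedExcess n (fun k => μ k + z k)) ∂stdNormal (Fin (2 ^ j)) ≤
      0.75 * (2 : ℝ) ^ ((j : ℝ) / 2) + 2 * ∑ k, μ k ^ 2 := by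
  set w : ℝ := (2 : ℝ) ^ ((j : ℝ) / 2) with hw
  have hw2 : w ^ 2 = (2 : ℝ) ^ j := two_rpow_half_sq j
  have hw1 : 1 ≤ w := Real.one_le_rpow (by norm_num) (by positivity)
  have hw0 : 0 < w := by linarith
  set A : ℝ := ∑ k, μ k ^ 2 with hA
  have hA0 : 0 ≤ A := Finset.sum_nonneg fun _ _ => sq_nonneg _
  have hm2 := memLp_excess μ
  have hint : Integrable (excess μ) (stdNormal (Fin (2 ^ j))) := hm2.integrable one_le_two
  have hint2 : Integrable (fun z => excess μ z ^ 2) (stdNormal (Fin (2 ^ j))) := hm2.integrable_sq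
  -- `y₊ ≤ (y + w)² / (4 w)`, which trades the mean of `y₊` for the variance of `y`
  have hpt : ∀ z, max 0 (killedExcess n (fun k => μ k + z k)) ≤
      (A + w / 4) + (1 / 2 * excess μ z + 1 / (4 * w) * excess μ z ^ 2) := by
    intro z
    have h1 : killedExcess n (fun k => μ k + z k) ≤ A + excess μ z := by
      refine (killedExcess_le hn hj _).trans_eq ?_
      rw [hA, ← sum_add_sq_sub_one, Fintype.card_fin]
      push_cast
      rfl
    have h2 : w / 4 + (1 / 2 * excess μ z + 1 / (4 * w) * excess μ z ^ 2) =
        (excess μ z + w) ^ 2 / (4 * w) := by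
      field_simp
      ring
    have h3 : excess μ z ≤ (excess μ z + w) ^ 2 / (4 * w) := by
      rw [le_div_iff₀ (by positivity)]
      nlinarith [sq_nonneg (excess μ z - w)]
    have h4 : 0 ≤ (excess μ z + w) ^ 2 / (4 * w) := by positivity
    apply max_le <;> linarith
  refine (integral_mono (integrable_max_killedExcess hn hj μ) ((integrable_const _).add
    ((hint.const_mul _).add (hint2.const_mul _))) hpt).trans ?_
  have k1 := integral_add (integrable_const (μ := stdNormal (Fin (2 ^ j))) (A + w / 4))
    ((hint.const_mul (1 / 2)).add (hint2.const_mul (1 / (4 * w))))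
  have k2 := integral_add (hint.const_mul (1 / 2)) (hint2.const_mul (1 / (4 * w)))
  simp only [Pi.add_apply] at k1 ⊢
  rw [k1, k2, integral_const_mul, integral_const_mul, integral_excess, integral_excess_sq,
    integral_const, probReal_univ, Fintype.card_fin, ← hA]
  push_cast
  rw [← hw2, smul_eq_mul]
  have e : 1 / (4 * w) * (4 * A + 2 * w ^ 2) = A / w + w / 2 := by
    field_simp
    ring
  have hAw : A / w ≤ A := div_le_self hA0 hw1
  rw [e]
  linarith

theorem integral_keptLength_le (hn : 1 < n) (hj : Real.log n ≤ (2 : ℝ) ^ j)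
    (hm : (2 : ℝ) ^ j ≤ n ^ 2) (μ : Fin (2 ^ j) → ℝ) :
    ∫ z, keptLength n (fun k => μ k + z k) ∂stdNormal (Fin (2 ^ j)) ≤
      0.095 * (2 : ℝ) ^ ((j : ℝ) / 2) + 10 ^ 6 * ∑ k, μ k ^ 2 := by
  set w : ℝ := (2 : ℝ) ^ ((j : ℝ) / 2) with hw
  have hw2 : w ^ 2 = (2 : ℝ) ^ j := two_rpow_half_sq j
  have hw0 : 0 < w := by positivity
  set P := stdNormal (Fin (2 ^ j)) with hP
  have hint : ∀ i, Integrable (fun z : Fin (2 ^ j) → ℝ =>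
      if lambdaStar * len n j i < blockSq n (fun k => μ k + z k) i then len n j i else 0) P := by
    intro i
    refine Integrable.of_bound (measurable_ite_lt_blockSq μ i).aestronglyMeasurable
      (len n j i) (Filter.Eventually.of_forall fun z => ?_)
    have h0 : 0 ≤ len n j i := Nat.cast_nonneg _
    split_ifs
    · rw [Real.norm_of_nonneg h0]
    · simpa using h0
  have hblock : ∀ i ∈ Finset.range (numBlocks n j), ∫ z : Fin (2 ^ j) → ℝ,
      (if lambdaStar * len n j i < blockSq n (fun k => μ k + z k) i then len n j i else 0) ∂P ≤
      0.095 / w * len n j i + 10 ^ 6 * blockSq n μ i := by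
    intro i hi
    have hl := len_pos hn (Finset.mem_range.1 hi)
    have hΞ := blockSq_nonneg (n := n) μ i
    set E : Set (Fin (2 ^ j) → ℝ) := {z | 6.9 * len n j i ≤ blockSq n z i} with hE
    have hEm : MeasurableSet E := measurableSet_le measurable_const (measurable_blockSq i)
    have hpt : ∀ z : Fin (2 ^ j) → ℝ,
        (if lambdaStar * len n j i < blockSq n (fun k => μ k + z k) i then len n j i else 0) ≤
        E.indicator (fun _ => len n j i) z + 10 ^ 6 * blockSq n μ i := by
      intro z
      have hind : 0 ≤ E.indicator (fun _ => len n j i) z :=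
        Set.indicator_nonneg (fun _ _ => hl.le) z
      split_ifs with h
      · by_cases hz : z ∈ E
        · rw [Set.indicator_of_mem hz]
          linarith
        · have hz' : blockSq n z i < 6.9 * len n j i := not_le.1 hz
          have h1 := blockSq_add_le (n := n) μ z i
          have h2 := mul_le_mul_of_nonneg_right lambdaStar_bounds.1 hl.le
          linarith
      · linarith
    refine (integral_mono (hint i) (((integrable_const _).indicator hEm).add
      (integrable_const _)) hpt).trans ?_
    have k1 := integral_add ((integrable_const (μ := P) (len n j i)).indicator hEm)
      (integrable_const (μ := P) (10 ^ 6 * blockSq n μ i))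
    simp only [Pi.add_apply]
    rw [k1, integral_indicator_const _ hEm, integral_const, probReal_univ, smul_eq_mul,
      smul_eq_mul, one_mul]
    have hp := measureReal_blockSq_ge_mul_le hn hm (Finset.mem_range.1 hi)
    have hp' : P.real E ≤ 0.095 / w := (le_div_iff₀ hw0).2 hp
    have := mul_le_mul_of_nonneg_right hp' hl.le
    linarith
  unfold keptLength
  rw [integral_finsetSum _ fun i _ => hint i]
  refine (Finset.sum_le_sum hblock).trans_eq ?_
  rw [Finset.sum_add_distrib, ← Finset.mul_sum, ← Finset.mul_sum, sum_len hn hj,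
    sum_blockSq hn hj, ← hw2]
  field_simp

end Risk

section Risk

variable {n : ℝ} {j : ℕ}

theorem unitRadiusSq_nonneg {α : ℝ} (h1 : α < 1) (x : Fin (2 ^ j) → ℝ) :
    0 ≤ unitRadiusSq n α x := by
  have hz := zUpper_nonneg (a := α / 2) (by linarith)
  have hk := keptLength_nonneg (n := n) x
  have hs := Real.sqrt_nonneg lambdaStar
  have hK : 0 ≤ 2 * lambdaStar + 8 * Real.sqrt lambdaStar - 1 := by
    linarith [lambdaStar_spec.1]
  have h := le_max_left 0 (killedExcess n x)
  unfold unitRadiusSq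
  positivity

theorem keptLength_coeff_le : 2 * lambdaStar + 8 * Real.sqrt lambdaStar - 1 ≤ 34 := by
  have h := lambdaStar_bounds.2
  have hs : Real.sqrt lambdaStar ≤ 2.6375 := Real.sqrt_le_iff.2 ⟨by norm_num, by linarith⟩
  linarith

theorem integrable_unitRadiusSq (hn : 1 < n) (hj : Real.log n ≤ (2 : ℝ) ^ j) (α : ℝ)
    (μ : Fin (2 ^ j) → ℝ) :
    Integrable (fun z => unitRadiusSq n α (fun k => μ k + z k)) (stdNormal (Fin (2 ^ j))) :=
  ((integrable_const _).add (integrable_max_killedExcess hn hj μ)).add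
    ((integrable_keptLength hn hj μ).const_mul _)

theorem integral_unitRadiusSq_eq (hn : 1 < n) (hj : Real.log n ≤ (2 : ℝ) ^ j) (α : ℝ)
    (μ : Fin (2 ^ j) → ℝ) :
    ∫ z, unitRadiusSq n α (fun k => μ k + z k) ∂stdNormal (Fin (2 ^ j)) =
      (2 * Real.sqrt (Real.log (2 / α)) + 4 * Real.sqrt lambdaStar * zUpper (α / 2))
        * (2 : ℝ) ^ ((j : ℝ) / 2)
      + ∫ z, max 0 (killedExcess n (fun k => μ k + z k)) ∂stdNormal (Fin (2 ^ j))
      + (2 * lambdaStar + 8 * Real.sqrt lambdaStar - 1) *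
        ∫ z, keptLength n (fun k => μ k + z k) ∂stdNormal (Fin (2 ^ j)) := by
  have i1 := integrable_max_killedExcess hn hj μ
  have i2 := integrable_keptLength hn hj μ
  have k1 := integral_add (integrable_const (μ := stdNormal (Fin (2 ^ j)))
    ((2 * Real.sqrt (Real.log (2 / α)) + 4 * Real.sqrt lambdaStar * zUpper (α / 2))
        * (2 : ℝ) ^ ((j : ℝ) / 2))) i1
  have k2 := integral_add ((integrable_const (μ := stdNormal (Fin (2 ^ j)))
    ((2 * Real.sqrt (Real.log (2 / α)) + 4 * Real.sqrt lambdaStar * zUpper (α / 2))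
        * (2 : ℝ) ^ ((j : ℝ) / 2))).add i1)
    (i2.const_mul (2 * lambdaStar + 8 * Real.sqrt lambdaStar - 1))
  have k3 := integral_const_mul (μ := stdNormal (Fin (2 ^ j)))
    (2 * lambdaStar + 8 * Real.sqrt lambdaStar - 1)
    (fun z => keptLength n (fun k => μ k + z k))
  simp only [Pi.add_apply] at k2
  unfold unitRadiusSq
  rw [k2, k1, k3, integral_const, probReal_univ, one_smul]

/-- The bound that is effective for a mean of small norm. -/
theorem integral_unitRadiusSq_le_norm (hn : 1 < n) (hj : Real.log n ≤ (2 : ℝ) ^ j)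
    (hm : (2 : ℝ) ^ j ≤ n ^ 2) (α : ℝ) (μ : Fin (2 ^ j) → ℝ) :
    ∫ z, unitRadiusSq n α (fun k => μ k + z k) ∂stdNormal (Fin (2 ^ j)) ≤
      (2 * Real.sqrt (Real.log (2 / α)) + 4 * Real.sqrt lambdaStar * zUpper (α / 2) + 4)
        * (2 : ℝ) ^ ((j : ℝ) / 2) + 10 ^ 8 * ∑ k, μ k ^ 2 := by
  rw [integral_unitRadiusSq_eq hn hj]
  have h1 := integral_max_killedExcess_le hn hj μ
  have h2 := integral_keptLength_le hn hj hm μ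
  have hA : 0 ≤ ∑ k, μ k ^ 2 := Finset.sum_nonneg fun _ _ => sq_nonneg _
  have hw : 0 ≤ (2 : ℝ) ^ ((j : ℝ) / 2) := by positivity
  have h3 : (2 * lambdaStar + 8 * Real.sqrt lambdaStar - 1) *
      ∫ z, keptLength n (fun k => μ k + z k) ∂stdNormal (Fin (2 ^ j)) ≤
      34 * (0.095 * (2 : ℝ) ^ ((j : ℝ) / 2) + 10 ^ 6 * ∑ k, μ k ^ 2) :=
    mul_le_mul keptLength_coeff_le h2 (integral_nonneg fun z => keptLength_nonneg _) (by norm_num)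
  linarith

/-- The bound that is effective for a mean of large norm. -/
theorem integral_unitRadiusSq_le_card (hn : 1 < n) (hj : Real.log n ≤ (2 : ℝ) ^ j) (α : ℝ)
    (μ : Fin (2 ^ j) → ℝ) :
    ∫ z, unitRadiusSq n α (fun k => μ k + z k) ∂stdNormal (Fin (2 ^ j)) ≤
      (2 * Real.sqrt (Real.log (2 / α)) + 4 * Real.sqrt lambdaStar * zUpper (α / 2) + 4)
        * (2 : ℝ) ^ ((j : ℝ) / 2) + 10 ^ 8 * (2 : ℝ) ^ j := by
  rw [integral_unitRadiusSq_eq hn hj]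
  have hb : ∀ {f : (Fin (2 ^ j) → ℝ) → ℝ} {c : ℝ}, Integrable f (stdNormal (Fin (2 ^ j))) →
      (∀ z, f z ≤ c) → ∫ z, f z ∂stdNormal (Fin (2 ^ j)) ≤ c := by
    intro f c hf hc
    refine (integral_mono hf (integrable_const c) hc).trans_eq ?_
    simp
  have h1 := hb (integrable_max_killedExcess hn hj μ) fun z => max_killedExcess_le hn hj _
  have h2 := hb (integrable_keptLength hn hj μ) fun z => keptLength_le hn hj _
  have hw : 0 ≤ (2 : ℝ) ^ ((j : ℝ) / 2) := by positivity
  have hm0 : 0 < (2 : ℝ) ^ j := by positivity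
  have h3 : (2 * lambdaStar + 8 * Real.sqrt lambdaStar - 1) *
      ∫ z, keptLength n (fun k => μ k + z k) ∂stdNormal (Fin (2 ^ j)) ≤ 34 * (2 : ℝ) ^ j :=
    mul_le_mul keptLength_coeff_le h2 (integral_nonneg fun z => keptLength_nonneg _) (by norm_num)
  have h4 : (lambdaStar - 1) * (2 : ℝ) ^ j ≤ 6 * (2 : ℝ) ^ j :=
    mul_le_mul_of_nonneg_right (by linarith [lambdaStar_bounds.2]) hm0.le
  linarith

end Risk

/-! ### Besov bodies -/

/-- `PiLp.norm_apply_le` without the restriction `1 ≤ q`. -/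
theorem norm_apply_le_norm_toLp {ι : Type*} [Fintype ι] {q : ℝ≥0∞} (hq : 0 < q) (f : ι → ℝ)
    (i : ι) : ‖f i‖ ≤ ‖WithLp.toLp q f‖ := by
  rcases eq_or_ne q ∞ with rfl | hq'
  · rw [PiLp.norm_eq_ciSup]
    exact le_ciSup (f := fun i => ‖f i‖) (Set.finite_range _).bddAbove i
  · have hq0 : 0 < q.toReal := ENNReal.toReal_pos hq.ne' hq'
    rw [PiLp.norm_eq_sum hq0, one_div, Real.le_rpow_inv_iff_of_pos (norm_nonneg _)
      (Finset.sum_nonneg fun _ _ => by positivity) hq0]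
    exact Finset.single_le_sum (f := fun i => ‖f i‖ ^ q.toReal)
      (fun i _ => by positivity) (Finset.mem_univ i)

/-- Comparison of the `ℓ²` and `ℓ^p` norms, with `p = ∞` included through `∞⁻¹ = 0`. -/
theorem sum_sq_le_card_rpow_mul_norm_sq {ι : Type*} [Fintype ι] [Nonempty ι] {p : ℝ≥0∞}
    (hp : 2 ≤ p) (x : ι → ℝ) :
    ∑ k, x k ^ 2 ≤ (Fintype.card ι : ℝ) ^ (1 - 2 * (p⁻¹).toReal) * ‖WithLp.toLp p x‖ ^ 2 := by
  have hcard : (0 : ℝ) < Fintype.card ι := by exact_mod_cast Fintype.card_pos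
  rcases eq_or_ne p ∞ with rfl | hp'
  · simp only [ENNReal.inv_top, ENNReal.toReal_zero, mul_zero, sub_zero, Real.rpow_one]
    refine (Finset.sum_le_card_nsmul _ _ (‖WithLp.toLp ∞ x‖ ^ 2) fun k _ => ?_).trans_eq (by
      rw [Finset.card_univ, nsmul_eq_mul])
    rw [← sq_abs]
    exact pow_le_pow_left₀ (abs_nonneg _) (norm_apply_le_norm_toLp (by simp) x k) 2
  · set P := p.toReal with hP
    have hP2 : 2 ≤ P := by
      have := ENNReal.toReal_mono hp' hp
      simpa using this
    have hP0 : 0 < P := by linarith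
    have hinv : (p⁻¹).toReal = P⁻¹ := ENNReal.toReal_inv p
    set A := ∑ k, x k ^ 2 with hA
    have hA0 : 0 ≤ A := Finset.sum_nonneg fun _ _ => sq_nonneg _
    set B := ∑ k, |x k| ^ P with hB
    have hB0 : 0 ≤ B := Finset.sum_nonneg fun _ _ => by positivity
    have hnorm : ‖WithLp.toLp p x‖ ^ 2 = B ^ (2 / P) := by
      rw [PiLp.norm_eq_sum hP0, ← Real.rpow_natCast, ← Real.rpow_mul (Finset.sum_nonneg
        fun _ _ => by positivity)]
      simp only [Real.norm_eq_abs, ← hP]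
      congr 1
      push_cast
      ring
    have h := Real.rpow_sum_le_const_mul_sum_rpow (s := Finset.univ) (f := fun k => x k ^ 2)
      (p := P / 2) (by linarith)
    have e1 : ∑ k, |x k ^ 2| = A := Finset.sum_congr rfl fun k _ => abs_of_nonneg (sq_nonneg _)
    have e2 : ∑ k, |x k ^ 2| ^ (P / 2) = B := Finset.sum_congr rfl fun k _ => by
      rw [abs_pow, ← Real.rpow_natCast, ← Real.rpow_mul (abs_nonneg _)]
      congr 1
      push_cast
      ring
    rw [e1, e2, Finset.card_univ] at h
    have h2 := Real.rpow_le_rpow (by positivity) h (by positivity : 0 ≤ 2 / P)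
    rw [← Real.rpow_mul hA0, Real.mul_rpow (by positivity) hB0, ← Real.rpow_mul hcard.le,
      show P / 2 * (2 / P) = 1 by field_simp, Real.rpow_one] at h2
    rw [hnorm, hinv]
    refine h2.trans_eq ?_
    congr 2
    field_simp

theorem sum_sq_le_of_mem_besovBody {J : ℕ} {β M : ℝ} {p q : ℝ≥0∞} (hp : 2 ≤ p) (hq : 0 < q)
    {θ : Coeffs J} (hθ : θ ∈ besovBody J β p q M) (j : Fin J) :
    ∑ k, θ j k ^ 2 ≤ M ^ 2 * (2 : ℝ) ^ (-2 * β * ((j : ℕ) : ℝ)) := by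
  have h1 := (norm_apply_le_norm_toLp hq (fun j : Fin J =>
      (2 : ℝ) ^ (((j : ℕ) : ℝ) * (β + 1 / 2 - (p⁻¹).toReal)) * ‖WithLp.toLp p (θ j)‖) j).trans hθ
  have hn0 : 0 ≤ ‖WithLp.toLp p (θ j)‖ := by
    refine (abs_nonneg _).trans (norm_apply_le_norm_toLp (lt_of_lt_of_le (by simp) hp) (θ j) ?_)
    exact ⟨0, by positivity⟩
  rw [Real.norm_of_nonneg (by positivity)] at h1
  have h2 := pow_le_pow_left₀ (by positivity) h1 2
  have h3 := sum_sq_le_card_rpow_mul_norm_sq hp (θ j)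
  rw [Fintype.card_fin] at h3
  refine h3.trans ?_
  set s : ℝ := β + 1 / 2 - (p⁻¹).toReal with hs
  rw [mul_pow, ← Real.rpow_natCast, ← Real.rpow_mul (by norm_num)] at h2
  have h4 := mul_le_mul_of_nonneg_right h2
    (by positivity : 0 ≤ (2 : ℝ) ^ (-2 * β * ((j : ℕ) : ℝ)))
  refine le_trans (le_of_eq ?_) h4
  rw [mul_right_comm, ← Real.rpow_add (by norm_num)]
  congr 1
  push_cast
  rw [← Real.rpow_natCast 2 (j : ℕ), ← Real.rpow_mul (by norm_num)]
  congr 1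
  rw [hs]
  ring

end ConfBall

end

theorem theorem2 :
    (∀ (n α : ℝ), 1 < n → 0 < α → α < 1 →
      ∀ (J : ℕ) (j : Fin J), (2 : ℝ) ^ (j : ℕ) ≤ n ^ 2 →
      ∀ θ : ConfBall.Coeffs J,
        1 - α - 2 / Real.log n ≤
          (ConfBall.noise J).real
            {z | θ j ∈ ConfBall.confBall n α (ConfBall.obs n θ z j)}) ∧
    (∀ β : ℝ, ∃ C : ℝ, 0 < C ∧
      ∀ (p q : ENNReal), 2 ≤ p → 0 < q → 0 < β + 1 / 2 - (p⁻¹).toReal →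
      ∀ (M n α : ℝ), 0 < M → 1 < n → 0 < α → α < 1 →
      ∀ (J : ℕ) (j : Fin J), Real.log n ≤ (2 : ℝ) ^ (j : ℕ) → (2 : ℝ) ^ (j : ℕ) ≤ n ^ 2 →
      ∀ θ ∈ ConfBall.besovBody J β p q M,
        MeasureTheory.Integrable
          (fun z => ConfBall.radius n α (ConfBall.obs n θ z j) ^ 2) (ConfBall.noise J) ∧
        ∫ z, ConfBall.radius n α (ConfBall.obs n θ z j) ^ 2 ∂(ConfBall.noise J) ≤
          (2 * Real.sqrt (Real.log (2 / α))
              + 4 * Real.sqrt ConfBall.lambdaStar * ConfBall.zUpper (α / 2) + 4)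
            * (2 : ℝ) ^ (((j : ℕ) : ℝ) / 2) * n⁻¹
          + C * min ((2 : ℝ) ^ (j : ℕ) * n⁻¹)
              (M ^ 2 * (2 : ℝ) ^ (-2 * β * ((j : ℕ) : ℝ)))) := by
  refine ⟨fun n α hn h0 h1 J j hm θ =>
    ConfBall.one_sub_le_measureReal_mem_confBall hn h0 h1 j hm θ, fun β =>
    ⟨10 ^ 8, by norm_num, ?_⟩⟩
  intro p q hp hq _ M n α _ hn _ h1 J j hj hm θ hθ
  have hn0 : 0 < n := by linarith
  have hi : 0 < n⁻¹ := inv_pos.2 hn0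
  set μ : Fin (2 ^ (j : ℕ)) → ℝ := fun k => Real.sqrt n * θ j k with hμ
  have hr : (fun z : ConfBall.Coeffs J => ConfBall.radius n α (ConfBall.obs n θ z j) ^ 2) =
      (fun z => n⁻¹ * ConfBall.unitRadiusSq n α (fun k => μ k + z k)) ∘
        (fun z : ConfBall.Coeffs J => z j) := by
    funext z
    have hnn := ConfBall.unitRadiusSq_nonneg (n := n) h1 (fun k => μ k + z j k)
    simp only [Function.comp_apply]
    rw [ConfBall.obs_eq hn0, ConfBall.radius, if_pos hj, ConfBall.blockRadiusSq_scale hn0,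
      Real.sq_sqrt (mul_nonneg hi.le hnn)]
  have hp' := ConfBall.measurePreserving_level j
  have hint := (ConfBall.integrable_unitRadiusSq hn hj α μ).const_mul n⁻¹
  have hE : ∫ z, ConfBall.radius n α (ConfBall.obs n θ z j) ^ 2 ∂(ConfBall.noise J) =
      n⁻¹ * ∫ z, ConfBall.unitRadiusSq n α (fun k => μ k + z k)
        ∂ConfBall.stdNormal (Fin (2 ^ (j : ℕ))) := by
    rw [hr, ← integral_const_mul, ← hp'.map_eq]
    exact (integral_map hp'.aemeasurable (by rw [hp'.map_eq]; exact hint.aestronglyMeasurable)).symm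
  refine ⟨by rw [hr]; exact hp'.integrable_comp_of_integrable hint, ?_⟩
  rw [hE, mul_min_of_nonneg _ _ (by norm_num : (0 : ℝ) ≤ 10 ^ 8), ← min_add_add_left]
  refine le_min ?_ ?_
  · refine (mul_le_mul_of_nonneg_left
      (ConfBall.integral_unitRadiusSq_le_card hn hj α μ) hi.le).trans_eq ?_
    ring
  · refine (mul_le_mul_of_nonneg_left
      (ConfBall.integral_unitRadiusSq_le_norm hn hj hm α μ) hi.le).trans ?_
    have hb := ConfBall.sum_sq_le_of_mem_besovBody hp hq hθ j
    have hs : ∑ k, μ k ^ 2 = n * ∑ k, θ j k ^ 2 := by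
      simp only [hμ, mul_pow, Real.sq_sqrt hn0.le, Finset.mul_sum]
    have hc : n⁻¹ * (10 ^ 8 * (n * ∑ k, θ j k ^ 2)) = 10 ^ 8 * ∑ k, θ j k ^ 2 := by
      field_simp
    rw [hs, mul_add, hc]
    linarith
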